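/- Let $(\tau,\alpha)$ be the pair of real numbers with $1.6701\le\tau<1.6702$ and $0.1950\le\alpha<0.1951$ that satisfies \[ \tau^{-1+\alpha}+\tau^{-4+3\alpha}+2\tau^{-6+4\alpha}+\tau^{-8+5\alpha}=1 \qquad\text{and}\qquad \tau^{-1}+\tau^{-1-4\alpha}=1 ; \] such a pair exists, so $\tau=1.6701\ldots$ and $\alpha=0.1950\ldots$. All theories and programs below are finite, and $n$ denotes the number of atoms that occur in the theory or program in question. 1. (CNF theories.) A clause is a set of literals (atoms and negated atoms), read as their disjunction; a CNF theory $T$ is a finite set of clauses, and it is a 3-CNF theory if every clause has at most three literals. A set $M$ of atoms of $T$ is a model of $T$ if every clause of $T$ contains an atom in $M$ or the negation of an atom not in $M$, and it is a minimal model if no proper subset of $M$ is a model of $T$. Every 3-CNF theory has at most $\tau^{n}$ minimal models. 2. (Normal programs.) A normal program $P$ is a finite set of rules $c\leftarrow a_1,\dots,a_r,\mathbf{not}(b_1),\dots,\mathbf{not}(b_s)$, where the $a_i$ are pairwise distinct atoms and the $b_j$ are pairwise distinct atoms; it is a 3-program if $1+r+s\le 3$ for every rule. The reduct $P^M$ with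 respect to a set $M$ of atoms is obtained by deleting every rule with some $b_j\in M$ and deleting the negated atoms $\mathbf{not}(b_j)$ from the remaining rules; $M$ is a stable model of $P$ if it is the least model of $P^M$. Every normal 3-program has at most $\tau^{n}$ stable models. 3. (Disjunctive programs.) A disjunctive program $P$ is a finite set of rules $c_1\vee\dots\vee c_p\leftarrow a_1,\dots,a_r,\mathbf{not}(b_1),\dots,\mathbf{not}(b_s)$ (with $p\ge 0$, the $c_i$, the $a_i$ and the $b_i$ each being pairwise distinct); it is a 3-program if $p+r+s\le 3$ for every rule. The reduct $P^M$ is defined as in 2., and $M$ is an answer set of $P$ if it is a minimal model of $P^M$. Every disjunctive 3-program has at most $\tau^{n}$ answer sets. -/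

import Mathlib

namespace ASP

/-! ### CNF theories and their minimal models -/

/-- A literal over the atoms `A`: an atom or its negation. -/
inductive Literal (A : Type*) where
  | pos (a : A) : Literal A
  | neg (a : A) : Literal A
  deriving DecidableEq

/-- The atom from which a literal is built. -/
def Literal.atom {A : Type*} : Literal A → A
  | .pos a => a
  | .neg a => a

/-- A clause is a (finite, possibly empty) disjunction of literals, viewed as the set of them. -/
abbrev Clause (A : Type*) := Finset (Literal A)

/-- A (finite) CNF theory is a set of clauses, read as their conjunction. -/
abbrev CNFTheory (A : Type*) := Finset (Clause A)

/-- `At(T)`: the atoms that occur in `T`. -/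
def CNFTheory.atoms {A : Type*} [DecidableEq A] (T : CNFTheory A) : Finset A :=
  T.biUnion fun c => c.image Literal.atom

/-- `T` is a `t`-CNF theory: no clause has more than `t` literals. -/
def CNFTheory.IsCNF {A : Type*} (t : ℕ) (T : CNFTheory A) : Prop :=
  ∀ c ∈ T, c.card ≤ t

/-- A set of atoms `M ⊆ At(T)` is a model of `T` if every clause of `T` contains an atom of `M` or
the negation of an atom outside `M`. -/
def CNFTheory.IsModel {A : Type*} [DecidableEq A] (T : CNFTheory A) (M : Finset A) : Prop :=
  M ⊆ T.atoms ∧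
    ∀ c ∈ T, (∃ a ∈ M, Literal.pos a ∈ c) ∨ (∃ a ∈ T.atoms \ M, Literal.neg a ∈ c)

/-- A model is minimal if none of its proper subsets is a model. -/
def CNFTheory.IsMinimalModel {A : Type*} [DecidableEq A] (T : CNFTheory A) (M : Finset A) : Prop :=
  T.IsModel M ∧ ∀ N : Finset A, N ⊂ M → ¬ T.IsModel N

/-! ### Normal logic programs and their stable models -/

/-- The normal program rule `head ← a₁, …, aᵣ, not b₁, …, not bₛ`
with `posBody = {a₁, …, aᵣ}` and `negBody = {b₁, …, bₛ}`. -/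
structure NormalRule (A : Type*) where
  head : A
  posBody : Finset A
  negBody : Finset A
  deriving DecidableEq

/-- A (finite propositional) normal logic program. -/
abbrev NormalProgram (A : Type*) := Finset (NormalRule A)

/-- `At(P)`: the atoms that occur in `P`. -/
def NormalProgram.atoms {A : Type*} [DecidableEq A] (P : NormalProgram A) : Finset A :=
  P.biUnion fun r => insert r.head (r.posBody ∪ r.negBody)

/-- `P` is a normal `t`-program: no rule has more than `t` literals. -/
def NormalProgram.IsTProgram {A : Type*} (t : ℕ) (P : NormalProgram A) : Prop :=
  ∀ r ∈ P, 1 + r.posBody.card + r.negBody.card ≤ t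

/-- `N` satisfies every rule of `P`. -/
def NormalProgram.IsModel {A : Type*} (P : NormalProgram A) (N : Finset A) : Prop :=
  ∀ r ∈ P, r.posBody ⊆ N → Disjoint r.negBody N → r.head ∈ N

/-- The Gelfond-Lifschitz reduct `P^M`: delete the rules with some `not b`, `b ∈ M`, and delete the
negated part of the body from the remaining rules. -/
def NormalProgram.reduct {A : Type*} [DecidableEq A] (P : NormalProgram A) (M : Finset A) :
    NormalProgram A :=
  (P.filter fun r => Disjoint r.negBody M).image fun r => ⟨r.head, r.posBody, ∅⟩

/-- `M` is a stable model of `P`: it is the least model of the reduct `P^M`. -/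
def NormalProgram.IsStableModel {A : Type*} [DecidableEq A] (P : NormalProgram A)
    (M : Finset A) : Prop :=
  IsLeast {N : Finset A | (P.reduct M).IsModel N} M

/-! ### Disjunctive logic programs and their answer sets -/

/-- The disjunctive program rule `c₁ ∨ … ∨ cₚ ← a₁, …, aᵣ, not b₁, …, not bₛ`
with `head = {c₁, …, cₚ}`, `posBody = {a₁, …, aᵣ}` and `negBody = {b₁, …, bₛ}`.
An empty head is allowed and stands for a contradiction. -/
structure DisjunctiveRule (A : Type*) where
  head : Finset A
  posBody : Finset A
  negBody : Finset A
  deriving DecidableEq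

/-- A (finite propositional) disjunctive logic program. -/
abbrev DisjunctiveProgram (A : Type*) := Finset (DisjunctiveRule A)

/-- `At(P)`: the atoms that occur in `P`. -/
def DisjunctiveProgram.atoms {A : Type*} [DecidableEq A] (P : DisjunctiveProgram A) : Finset A :=
  P.biUnion fun r => r.head ∪ r.posBody ∪ r.negBody

/-- `P` is a disjunctive `t`-program: no rule has more than `t` literals. -/
def DisjunctiveProgram.IsTProgram {A : Type*} (t : ℕ) (P : DisjunctiveProgram A) : Prop :=
  ∀ r ∈ P, r.head.card + r.posBody.card + r.negBody.card ≤ t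

/-- `N` satisfies every rule of `P`. -/
def DisjunctiveProgram.IsModel {A : Type*} (P : DisjunctiveProgram A) (N : Finset A) : Prop :=
  ∀ r ∈ P, r.posBody ⊆ N → Disjoint r.negBody N → ∃ c ∈ r.head, c ∈ N

/-- The Gelfond-Lifschitz reduct `P^M`. -/
def DisjunctiveProgram.reduct {A : Type*} [DecidableEq A] (P : DisjunctiveProgram A)
    (M : Finset A) : DisjunctiveProgram A :=
  (P.filter fun r => Disjoint r.negBody M).image fun r => ⟨r.head, r.posBody, ∅⟩

/-- `M` is an answer set of `P`: it is a minimal model of the reduct `P^M`. -/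
def DisjunctiveProgram.IsAnswerSet {A : Type*} [DecidableEq A] (P : DisjunctiveProgram A)
    (M : Finset A) : Prop :=
  (P.reduct M).IsModel M ∧ ∀ N : Finset A, N ⊂ M → ¬ (P.reduct M).IsModel N

end ASP

/-!
A minimal model `M` of a theory is irredundant: removing a single atom `a` from `M` always violates
some clause, namely a clause in which the literal `a` is the only true one. Irredundant models are
counted instead of minimal ones, because this property passes to the residual theory after a partial
assignment (`Irredundant.assign`), and because it permits a strong kind of branching: if an atom `a`
is true, then all other literals of one of the clauses with `a` are false.

The bound is proved in the form `base ^ n / gain ^ k`, where `n` is the number of atoms, `k` is the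
size of a matching of two-literal clauses (clauses of which no two share an atom), `base = 1.6701`
and `gain = 1.1` (`bounded`). The induction is on `n`. Each step covers the irredundant models by a
few partial assignments; one that fixes `m` atoms, and hits `j` clauses of the matching, contributes
at most the fraction `base ^ (-m) * gain ^ j` of the bound, and less if it creates new two-literal
clauses. The fractions have to add up to at most one.

* If two-literal clauses meet, they belong to a star, or an atom occurs in them with both signs;
  either way the bound has room to spare (`ratio_of_touching`). The room is measured for one and for
  two clauses beside a matching (`ratio_of_extra`, `ratio_of_two_extra`) and, without a matching, for
  up to five two-literal clauses (`shortBound_one` to `shortBound_five`).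
* If all two-literal clauses form a nonempty matching, branch on one of them: a suitable literal of
  it, when it becomes false, turns three-literal clauses into additional two-literal clauses
  (`Reduced.ratio_of_neg`, `Reduced.ratio_of_pos`).
* If all clauses have three literals, an atom with at most two positive occurrences is settled by
  the clause on which it depends, and an atom with three positive and one negative occurrence by
  plain branching. What remains is a 3-uniform hypergraph of minimum degree three. Degree five is
  settled by the five two-literal clauses that appear, degree three by
  `PositiveUniform.ratio_of_degree_le_three`, and in a 4-regular hypergraph making one vertex true
  lowers the degree of another one to three or less (`PositiveUniform.ratio`).

Stable models of a normal program are answer sets of the same program read as a disjunctive one, and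
answer sets are minimal, hence irredundant, models of the clauses of the program
(`DisjunctiveProgram.IsAnswerSet.mem_irr`). Finally `τ` and `α` are obtained from the intermediate
value theorem (`exists_constants`), and `base ≤ τ`.
-/

namespace ASP

/-! ### Irredundant models and partial assignments -/

section Irredundant

variable {A : Type*}

/-- The complementary literal. -/
def Literal.compl : Literal A → Literal A
  | .pos a => .neg a
  | .neg a => .pos a

/-- The literal `l` is true in the interpretation whose true atoms are those of `M`. -/
def Literal.Holds (M : Finset A) : Literal A → Prop
  | .pos a => a ∈ M
  | .neg a => a ∉ M

@[simp] lemma Literal.compl_compl (l : Literal A) : l.compl.compl = l := by cases l <;> rfl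

@[simp] lemma Literal.atom_compl (l : Literal A) : l.compl.atom = l.atom := by cases l <;> rfl

lemma Literal.holds_compl (M : Finset A) (l : Literal A) : l.compl.Holds M ↔ ¬ l.Holds M := by
  cases l <;> simp [compl, Holds]

lemma Literal.eq_or_eq_compl {l l' : Literal A} (h : l.atom = l'.atom) :
    l = l' ∨ l = l'.compl := by
  cases l <;> cases l' <;> simp_all [atom, compl]

lemma Literal.holds_congr {M N : Finset A} {l : Literal A} (h : l.atom ∈ M ↔ l.atom ∈ N) :
    l.Holds M ↔ l.Holds N := by
  cases l <;> simp_all [Holds, atom]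

/-- `M` satisfies every clause of `T`. Atoms that do not occur in `T` are unrestricted. -/
def Models (T : CNFTheory A) (M : Finset A) : Prop :=
  ∀ c ∈ T, ∃ l ∈ c, l.Holds M

variable [DecidableEq A]

/-- A model from which no single atom can be removed. Minimal models are irredundant, and
irredundance, unlike minimality, is a condition on single clauses: every true atom `a` has a clause
in which the literal `a` is the only true one. -/
def Irredundant (T : CNFTheory A) (M : Finset A) : Prop :=
  Models T M ∧ ∀ a ∈ M, ¬ Models T (M.erase a)

open scoped Classical in
/-- The irredundant models of `T` with all atoms in `V`. -/
noncomputable def irr (V : Finset A) (T : CNFTheory A) : Finset (Finset A) :=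
  {M ∈ V.powerset | Irredundant T M}

open scoped Classical in
/-- The irredundant models of `T` in which all literals of `L` are true. -/
noncomputable def irrOn (V : Finset A) (T : CNFTheory A) (L : Finset (Literal A)) :
    Finset (Finset A) :=
  {M ∈ irr V T | ∀ l ∈ L, l.Holds M}

/-- The residual theory after all literals of `L` have been made true: the clauses that contain a
literal of `L` disappear, the others lose the literals that have become false. -/
def assign (T : CNFTheory A) (L : Finset (Literal A)) : CNFTheory A :=
  (T.filter fun c => Disjoint c L).image fun c => c \ L.image Literal.compl

/-- The atoms of a set of literals. -/
abbrev atomsOf (L : Finset (Literal A)) : Finset A := L.image Literal.atom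

/-- `T` is a 3-CNF theory over the atoms `V` without tautological clauses. -/
structure Wf (V : Finset A) (T : CNFTheory A) : Prop where
  card_le : ∀ c ∈ T, c.card ≤ 3
  compl_notMem : ∀ c ∈ T, ∀ l ∈ c, l.compl ∉ c
  atom_mem : ∀ c ∈ T, ∀ l ∈ c, l.atom ∈ V

/-- `K` is a set of two-literal clauses of `T`, no two of which have an atom in common. -/
structure IsMatching (T K : CNFTheory A) : Prop where
  subset : K ⊆ T
  card_eq : ∀ c ∈ K, c.card = 2
  eq_of_atom : ∀ c ∈ K, ∀ c' ∈ K, ∀ l ∈ c, ∀ l' ∈ c', l.atom = l'.atom → c = c'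

lemma mem_irr {V : Finset A} {T : CNFTheory A} {M : Finset A} :
    M ∈ irr V T ↔ M ⊆ V ∧ Irredundant T M := by
  simp [irr]

lemma mem_irrOn {V : Finset A} {T : CNFTheory A} {L : Finset (Literal A)} {M : Finset A} :
    M ∈ irrOn V T L ↔ M ∈ irr V T ∧ ∀ l ∈ L, l.Holds M := by
  simp [irrOn]

/-- Every true atom of an irredundant model has a clause that depends on it alone. -/
lemma Irredundant.exists_critical {T : CNFTheory A} {M : Finset A} (h : Irredundant T M) {a : A}
    (ha : a ∈ M) :
    ∃ c ∈ T, Literal.pos a ∈ c ∧ ∀ l ∈ c, l ≠ Literal.pos a → ¬ l.Holds M := by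
  have h2 := h.2 a ha
  unfold Models at h2
  push Not at h2
  obtain ⟨c, hc, hf⟩ := h2
  have key : ∀ l ∈ c, l.Holds M → l = Literal.pos a := by
    intro l hl hM
    have := hf l hl
    cases l with
    | pos b => simp_all [Literal.Holds]
    | neg b => simp_all [Literal.Holds]
  obtain ⟨l, hl, hM⟩ := h.1 c hc
  exact ⟨c, hc, key l hl hM ▸ hl, fun l hl hne hM => hne (key l hl hM)⟩

lemma mem_assign {T : CNFTheory A} {L : Finset (Literal A)} {c : Clause A} :
    c ∈ assign T L ↔ ∃ d ∈ T, Disjoint d L ∧ d \ L.image Literal.compl = c := by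
  simp [assign, and_assoc]

lemma mem_image_compl {L : Finset (Literal A)} {l : Literal A} :
    l ∈ L.image Literal.compl ↔ l.compl ∈ L := by
  constructor
  · intro h
    obtain ⟨x, hx, rfl⟩ := Finset.mem_image.1 h
    simpa using hx
  · intro h
    exact Finset.mem_image.2 ⟨_, h, by simp⟩

lemma atom_notMem_atomsOf {L : Finset (Literal A)} {l : Literal A} (h1 : l ∉ L)
    (h2 : l.compl ∉ L) : l.atom ∉ atomsOf L := by
  intro h
  obtain ⟨x, hx, hxl⟩ := Finset.mem_image.1 h
  rcases Literal.eq_or_eq_compl hxl with rfl | rfl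
  · exact h1 hx
  · exact h2 hx

lemma Wf.assign {V : Finset A} {T : CNFTheory A} (h : Wf V T) (L : Finset (Literal A)) :
    Wf (V \ atomsOf L) (assign T L) := by
  refine ⟨?_, ?_, ?_⟩ <;> intro c hc <;> obtain ⟨d, hd, hdL, rfl⟩ := mem_assign.1 hc
  · exact (Finset.card_le_card Finset.sdiff_subset).trans (h.card_le d hd)
  · intro l hl hl'
    exact h.compl_notMem d hd l (Finset.mem_sdiff.1 hl).1 (Finset.mem_sdiff.1 hl').1
  · intro l hl
    obtain ⟨hl, hl'⟩ := Finset.mem_sdiff.1 hl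
    rw [mem_image_compl] at hl'
    exact Finset.mem_sdiff.2 ⟨h.atom_mem d hd l hl,
      atom_notMem_atomsOf (Finset.disjoint_left.1 hdL hl) hl'⟩

/-- Deleting the assigned atoms turns an irredundant model of `T` that agrees with `L` into an
irredundant model of the residual theory. -/
lemma Irredundant.assign {T : CNFTheory A} {L : Finset (Literal A)} {M : Finset A}
    (h : Irredundant T M) (hL : ∀ l ∈ L, l.Holds M) :
    Irredundant (assign T L) (M \ atomsOf L) := by
  have hfree : ∀ N : Finset A, ∀ l : Literal A, l ∉ L → l.compl ∉ L →
      (l.Holds (N \ atomsOf L) ↔ l.Holds N) := by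
    intro N l h1 h2
    apply Literal.holds_congr
    simp only [Finset.mem_sdiff, and_iff_left_iff_imp]
    exact fun _ => atom_notMem_atomsOf h1 h2
  constructor
  · intro c hc
    obtain ⟨d, hd, hdL, rfl⟩ := mem_assign.1 hc
    obtain ⟨l, hl, hM⟩ := h.1 d hd
    have hl2 : l.compl ∉ L := fun hh => (Literal.holds_compl M l).1 (hL _ hh) hM
    exact ⟨l, Finset.mem_sdiff.2 ⟨hl, by rwa [mem_image_compl]⟩,
      (hfree M l (Finset.disjoint_left.1 hdL hl) hl2).2 hM⟩
  · intro a ha hmod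
    obtain ⟨haM, haL⟩ := Finset.mem_sdiff.1 ha
    refine h.2 a haM fun c hc => ?_
    by_cases hcL : Disjoint c L
    · obtain ⟨l, hl, hh⟩ := hmod _ (mem_assign.2 ⟨c, hc, hcL, rfl⟩)
      obtain ⟨hl, hl'⟩ := Finset.mem_sdiff.1 hl
      rw [mem_image_compl] at hl'
      refine ⟨l, hl, ?_⟩
      have : (M \ atomsOf L).erase a = M.erase a \ atomsOf L := by
        rw [Finset.erase_sdiff_comm]
      rw [this] at hh
      exact (hfree _ l (Finset.disjoint_left.1 hcL hl) hl').1 hh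
    · obtain ⟨l, hl, hlL⟩ := Finset.not_disjoint_iff.1 hcL
      refine ⟨l, hl, (Literal.holds_congr ?_).1 (hL l hlL)⟩
      have : l.atom ≠ a := fun h => haL (h ▸ Finset.mem_image_of_mem _ hlL)
      simp [this]

lemma card_irrOn_le (V : Finset A) (T : CNFTheory A) (L : Finset (Literal A)) :
    (irrOn V T L).card ≤ (irr (V \ atomsOf L) (assign T L)).card := by
  refine Finset.card_le_card_of_injOn (fun M => M \ atomsOf L) ?_ ?_
  · intro M hM
    obtain ⟨hM, hL⟩ := mem_irrOn.1 hM
    obtain ⟨hV, hI⟩ := mem_irr.1 hM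
    exact mem_irr.2 ⟨Finset.sdiff_subset_sdiff hV le_rfl, hI.assign hL⟩
  · intro M hM N hN hMN
    have hM := (mem_irrOn.1 hM).2
    have hN := (mem_irrOn.1 hN).2
    ext a
    by_cases ha : a ∈ atomsOf L
    · obtain ⟨l, hl, rfl⟩ := Finset.mem_image.1 ha
      have h1 := hM l hl
      have h2 := hN l hl
      cases l <;> simp_all [Literal.Holds, Literal.atom]
    · have := Finset.ext_iff.1 hMN a
      simpa [ha] using this

lemma irrOn_eq_empty {V : Finset A} {T : CNFTheory A} {L : Finset (Literal A)} {l : Literal A}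
    (h1 : l ∈ L) (h2 : l.compl ∈ L) : irrOn V T L = ∅ := by
  refine Finset.eq_empty_of_forall_notMem fun M hM => ?_
  have := (mem_irrOn.1 hM).2
  exact (Literal.holds_compl M l).1 (this _ h2) (this _ h1)

lemma card_sdiff_atomsOf {V : Finset A} {L : Finset (Literal A)} (hV : ∀ l ∈ L, l.atom ∈ V)
    (hL : ∀ l ∈ L, l.compl ∉ L) : (V \ atomsOf L).card + L.card = V.card := by
  have hinj : Set.InjOn Literal.atom (L : Set (Literal A)) := by
    intro l hl l' hl' h
    rcases Literal.eq_or_eq_compl h with h | h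
    · exact h
    · exact absurd (h ▸ hl) (hL l' hl')
  have hsub : atomsOf L ⊆ V := fun a ha => by
    obtain ⟨l, hl, rfl⟩ := Finset.mem_image.1 ha
    exact hV l hl
  rw [← Finset.card_image_of_injOn hinj]
  exact Finset.card_sdiff_add_card_eq_card hsub

/-- The part of a matching that survives an assignment. -/
def untouched (K : CNFTheory A) (L : Finset (Literal A)) : CNFTheory A :=
  K.filter fun c => ∀ l ∈ c, l.atom ∉ atomsOf L

lemma IsMatching.untouched {T K : CNFTheory A} (h : IsMatching T K) (L : Finset (Literal A)) :
    IsMatching (ASP.assign T L) (untouched K L) := by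
  refine ⟨?_, ?_, ?_⟩
  · intro c hc
    obtain ⟨hc, hu⟩ := Finset.mem_filter.1 hc
    have h1 : ∀ l ∈ c, l ∉ L := fun l hl hlL => hu l hl (Finset.mem_image_of_mem _ hlL)
    have h2 : ∀ l ∈ c, l ∉ L.image Literal.compl := fun l hl hlL => by
      rw [mem_image_compl] at hlL
      exact hu l hl (Finset.mem_image.2 ⟨_, hlL, by simp⟩)
    exact mem_assign.2 ⟨c, h.subset hc, Finset.disjoint_left.2 h1,
      Finset.sdiff_eq_self_of_disjoint (Finset.disjoint_left.2 h2)⟩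
  · exact fun c hc => h.card_eq c (Finset.mem_filter.1 hc).1
  · exact fun c hc c' hc' => h.eq_of_atom c (Finset.mem_filter.1 hc).1 c' (Finset.mem_filter.1 hc').1

/-- An assignment destroys at most one clause of a matching for each literal. The literals of `L`
whose clause is also met by a literal of `L'` need not be counted. -/
lemma IsMatching.card_le {T K : CNFTheory A} (h : IsMatching T K) {L L' : Finset (Literal A)}
    (hL : ∀ c ∈ K, ∀ l ∈ c, l.atom ∈ atomsOf L → ∃ l ∈ c, l.atom ∈ atomsOf L') :
    K.card ≤ (ASP.untouched K L).card + L'.card := by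
  classical
  have hsub : K ⊆ ASP.untouched K L ∪
      L'.biUnion fun l => K.filter fun c => l.atom ∈ atomsOf c := by
    intro c hc
    by_cases hu : ∀ l ∈ c, l.atom ∉ atomsOf L
    · exact Finset.mem_union_left _ (Finset.mem_filter.2 ⟨hc, hu⟩)
    · push Not at hu
      obtain ⟨l, hl, hlL⟩ := hu
      obtain ⟨l', hl', ha⟩ := hL c hc l hl hlL
      obtain ⟨m, hm, hma⟩ := Finset.mem_image.1 ha
      refine Finset.mem_union_right _ (Finset.mem_biUnion.2 ⟨m, hm, Finset.mem_filter.2 ⟨hc, ?_⟩⟩)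
      exact Finset.mem_image.2 ⟨l', hl', hma.symm⟩
  refine (Finset.card_le_card hsub).trans ((Finset.card_union_le _ _).trans ?_)
  refine Nat.add_le_add_left ?_ _
  refine (Finset.card_biUnion_le_card_mul _ _ 1 fun l _ => ?_).trans (by simp)
  refine Finset.card_le_one.2 fun c hc c' hc' => ?_
  obtain ⟨hc, hl⟩ := Finset.mem_filter.1 hc
  obtain ⟨hc', hl'⟩ := Finset.mem_filter.1 hc'
  obtain ⟨m, hm, hma⟩ := Finset.mem_image.1 hl
  obtain ⟨m', hm', hma'⟩ := Finset.mem_image.1 hl'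
  exact h.eq_of_atom c hc c' hc' m hm m' hm' (hma.trans hma'.symm)

omit [DecidableEq A] in
lemma IsMatching.empty (T : CNFTheory A) : IsMatching T ∅ := ⟨by simp, by simp, by simp⟩

/-- Irredundance depends on the class of models only. -/
lemma irr_congr {V : Finset A} {T T' : CNFTheory A} (h : ∀ M, Models T M ↔ Models T' M) :
    irr V T = irr V T' := by
  ext M
  simp [mem_irr, Irredundant, h]

end Irredundant

/-! ### Ratios -/

section Ratio

variable {A : Type*} [DecidableEq A]

/-- The base of the bound that is proved by induction; it is at most `τ`. -/
noncomputable def base : ℝ := 16701 / 10000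

/-- Each clause of a matching of two-literal clauses improves the bound by this factor. -/
noncomputable def gain : ℝ := 11 / 10

/-- The number of irredundant models of `T` is at most `r` times the bound that the induction aims
at, `base ^ |V| / gain ^ |K|`. -/
def Ratio (V : Finset A) (T K : CNFTheory A) (r : ℝ) : Prop :=
  ((irr V T).card : ℝ) * gain ^ K.card ≤ r * base ^ V.card

/-- As `Ratio`, for the irredundant models in which the literals of `L` are true. -/
def RatioOn (V : Finset A) (T K : CNFTheory A) (L : Finset (Literal A)) (r : ℝ) : Prop :=
  ((irrOn V T L).card : ℝ) * gain ^ K.card ≤ r * base ^ V.card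

/-- The inductive statement, for at most `N` atoms. -/
def Bounded (A : Type*) [DecidableEq A] (N : ℕ) : Prop :=
  ∀ (V : Finset A) (T K : CNFTheory A), V.card ≤ N → Wf V T → IsMatching T K → Ratio V T K 1

lemma base_pow_pos (n : ℕ) : 0 < base ^ n := by
  unfold base; positivity

lemma gain_pow_pos (n : ℕ) : 0 < gain ^ n := by
  unfold gain; positivity

lemma one_le_gain : 1 ≤ gain := by norm_num [gain]

lemma one_le_base : 1 ≤ base := by norm_num [base]

lemma Ratio.mono {V : Finset A} {T K : CNFTheory A} {r r' : ℝ} (h : Ratio V T K r) (hr : r ≤ r') :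
    Ratio V T K r' :=
  h.trans (mul_le_mul_of_nonneg_right hr (base_pow_pos _).le)

/-- The step of every branching. Making the literals of `L` true removes `m` atoms at least and
destroys `j` clauses of the matching at most, and the residual theory has ratio `r`. -/
lemma RatioOn.of_assign {V : Finset A} {T K : CNFTheory A} {L : Finset (Literal A)} {r : ℝ}
    (m j : ℕ) (hr : 0 ≤ r) (hV : ∀ l ∈ L, l.atom ∈ V)
    (h : (∀ l ∈ L, l.compl ∉ L) → m ≤ L.card ∧ K.card ≤ (untouched K L).card + j ∧
      Ratio (V \ atomsOf L) (assign T L) (untouched K L) r) :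
    RatioOn V T K L (r * base⁻¹ ^ m * gain ^ j) := by
  unfold RatioOn
  by_cases hL : ∀ l ∈ L, l.compl ∉ L
  · obtain ⟨hm, hj, hR⟩ := h hL
    have hcard := card_sdiff_atomsOf hV hL
    unfold Ratio at hR
    set k' := (untouched K L).card
    set n' := (V \ atomsOf L).card
    have h1 : ((irrOn V T L).card : ℝ) ≤ (irr (V \ atomsOf L) (assign T L)).card := by
      exact_mod_cast card_irrOn_le V T L
    have h2 : gain ^ K.card ≤ gain ^ k' * gain ^ j := by
      rw [← pow_add]; exact pow_le_pow_right₀ one_le_gain hj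
    have h3 : base ^ n' ≤ base⁻¹ ^ m * base ^ V.card := by
      rw [inv_pow, le_inv_mul_iff₀ (base_pow_pos m), ← pow_add]
      exact pow_le_pow_right₀ one_le_base (by omega)
    calc ((irrOn V T L).card : ℝ) * gain ^ K.card
        ≤ (irr (V \ atomsOf L) (assign T L)).card * (gain ^ k' * gain ^ j) :=
          mul_le_mul h1 h2 (gain_pow_pos _).le (Nat.cast_nonneg _)
      _ = (irr (V \ atomsOf L) (assign T L)).card * gain ^ k' * gain ^ j := by ring
      _ ≤ r * base ^ n' * gain ^ j := mul_le_mul_of_nonneg_right hR (gain_pow_pos _).le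
      _ ≤ r * (base⁻¹ ^ m * base ^ V.card) * gain ^ j :=
          mul_le_mul_of_nonneg_right (mul_le_mul_of_nonneg_left h3 hr) (gain_pow_pos _).le
      _ = r * base⁻¹ ^ m * gain ^ j * base ^ V.card := by ring
  · push Not at hL
    obtain ⟨l, h1, h2⟩ := hL
    rw [irrOn_eq_empty h1 h2]
    simp only [Finset.card_empty, Nat.cast_zero, zero_mul]
    have := base_pow_pos V.card
    have := gain_pow_pos j
    have : 0 < base⁻¹ ^ m := pow_pos (inv_pos.2 (by norm_num [base])) _
    positivity

lemma Ratio.of_cover {V : Finset A} {T K : CNFTheory A} {ι : Type*} (s : Finset ι)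
    (L : ι → Finset (Literal A)) (r : ι → ℝ)
    (hc : ∀ M ∈ irr V T, ∃ i ∈ s, ∀ l ∈ L i, l.Holds M) (h : ∀ i ∈ s, RatioOn V T K (L i) (r i)) :
    Ratio V T K (∑ i ∈ s, r i) := by
  classical
  have hsub : irr V T ⊆ s.biUnion fun i => irrOn V T (L i) := by
    intro M hM
    obtain ⟨i, hi, hl⟩ := hc M hM
    exact Finset.mem_biUnion.2 ⟨i, hi, mem_irrOn.2 ⟨hM, hl⟩⟩
  have h1 : ((irr V T).card : ℝ) ≤ ∑ i ∈ s, ((irrOn V T (L i)).card : ℝ) := by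
    exact_mod_cast (Finset.card_le_card hsub).trans Finset.card_biUnion_le
  unfold Ratio
  rw [Finset.sum_mul]
  calc _ ≤ (∑ i ∈ s, ((irrOn V T (L i)).card : ℝ)) * gain ^ K.card :=
        mul_le_mul_of_nonneg_right h1 (gain_pow_pos _).le
    _ = ∑ i ∈ s, ((irrOn V T (L i)).card : ℝ) * gain ^ K.card := Finset.sum_mul ..
    _ ≤ _ := Finset.sum_le_sum h

lemma Ratio.of_cover_one {V : Finset A} {T K : CNFTheory A} {L : Finset (Literal A)} {r : ℝ}
    (hc : ∀ M ∈ irr V T, ∀ l ∈ L, l.Holds M) (h : RatioOn V T K L r) : Ratio V T K r := by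
  have := Ratio.of_cover {()} (fun _ => L) (fun _ => r) (fun M hM => ⟨(), by simp, hc M hM⟩)
    (fun _ _ => h)
  simpa using this

lemma Ratio.of_cover_two {V : Finset A} {T K : CNFTheory A} {L₁ L₂ : Finset (Literal A)}
    {r₁ r₂ : ℝ} (hc : ∀ M ∈ irr V T, (∀ l ∈ L₁, l.Holds M) ∨ (∀ l ∈ L₂, l.Holds M))
    (h₁ : RatioOn V T K L₁ r₁) (h₂ : RatioOn V T K L₂ r₂) : Ratio V T K (r₁ + r₂) := by
  have := Ratio.of_cover Finset.univ (fun b : Bool => cond b L₁ L₂) (fun b => cond b r₁ r₂)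
    (K := K) (T := T) (V := V)
    (fun M hM => (hc M hM).elim (fun h => ⟨true, by simp, h⟩) (fun h => ⟨false, by simp, h⟩))
    (by intro b _; cases b <;> assumption)
  simpa using this

lemma Ratio.of_card_irr_eq_zero {V : Finset A} {T K : CNFTheory A} {r : ℝ} (hr : 0 ≤ r)
    (h : irr V T = ∅) : Ratio V T K r := by
  have := base_pow_pos V.card
  simp only [Ratio, h, Finset.card_empty, Nat.cast_zero, zero_mul]
  positivity

end Ratio

/-! ### Theories with several two-literal clauses -/

section Short

variable {A : Type*} [DecidableEq A]

/-- `T` has a clause with at most one literal, or at least `e` clauses with two literals. -/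
def HasShort (e : ℕ) (T : CNFTheory A) : Prop :=
  (∃ c ∈ T, c.card ≤ 1) ∨ ∃ E ⊆ T, (∀ c ∈ E, c.card = 2) ∧ e ≤ E.card

/-- Theories over at most `N` atoms with at least `e` two-literal clauses have ratio `r`. -/
def ShortBound (A : Type*) [DecidableEq A] (N e : ℕ) (r : ℝ) : Prop :=
  ∀ (V : Finset A) (T : CNFTheory A), V.card ≤ N → Wf V T → HasShort e T → Ratio V T ∅ r

omit [DecidableEq A] in
lemma HasShort.mono {e e' : ℕ} {T : CNFTheory A} (h : HasShort e T) (he : e' ≤ e) :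
    HasShort e' T :=
  h.imp id fun ⟨E, h1, h2, h3⟩ => ⟨E, h1, h2, he.trans h3⟩

omit [DecidableEq A] in
lemma hasShort_zero (T : CNFTheory A) : HasShort 0 T := Or.inr ⟨∅, by simp, by simp, by simp⟩

lemma hasShort_assign_of_injOn {T C : CNFTheory A} {L : Finset (Literal A)} (hC : C ⊆ T)
    (hd : ∀ c ∈ C, Disjoint c L) (h2 : ∀ c ∈ C, (c \ L.image Literal.compl).card ≤ 2)
    (hinj : ∀ c ∈ C, ∀ c' ∈ C, (c \ L.image Literal.compl).card = 2 →
      c \ L.image Literal.compl = c' \ L.image Literal.compl → c = c') :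
    HasShort C.card (assign T L) := by
  have hmem : ∀ c ∈ C, c \ L.image Literal.compl ∈ assign T L :=
    fun c hc => mem_assign.2 ⟨c, hC hc, hd c hc, rfl⟩
  by_cases hu : ∃ c ∈ C, (c \ L.image Literal.compl).card ≤ 1
  · obtain ⟨c, hc, hle⟩ := hu
    exact Or.inl ⟨_, hmem c hc, hle⟩
  · push Not at hu
    have heq : ∀ c ∈ C, (c \ L.image Literal.compl).card = 2 := fun c hc =>
      le_antisymm (h2 c hc) (hu c hc)
    refine Or.inr ⟨C.image fun c => c \ L.image Literal.compl, ?_, ?_, ?_⟩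
    · exact Finset.image_subset_iff.2 hmem
    · intro c hc
      obtain ⟨d, hd, rfl⟩ := Finset.mem_image.1 hc
      exact heq d hd
    · rw [Finset.card_image_of_injOn]
      exact fun c hc c' hc' h => hinj c hc c' hc' (heq c hc) h

/-- Two-literal clauses without a literal of `L` stay, or shrink further. -/
lemma hasShort_assign_of_two {T C : CNFTheory A} {L : Finset (Literal A)} (hC : C ⊆ T)
    (h2 : ∀ c ∈ C, c.card = 2) (hd : ∀ c ∈ C, Disjoint c L) : HasShort C.card (assign T L) := by
  refine hasShort_assign_of_injOn hC hd (fun c hc => ?_) fun c hc c' hc' h h' => ?_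
  · exact (Finset.card_le_card Finset.sdiff_subset).trans (h2 c hc).le
  · have e1 := Finset.eq_of_subset_of_card_le (Finset.sdiff_subset (s := c)
      (t := L.image Literal.compl)) (by rw [h, h2 c hc])
    have e2 := Finset.eq_of_subset_of_card_le (Finset.sdiff_subset (s := c')
      (t := L.image Literal.compl)) (by rw [← h', h, h2 c' hc'])
    rw [← e1, ← e2, h']

/-- Three-literal clauses with a common literal `l` become two-literal clauses, or even shorter,
when `l` becomes false. -/
lemma hasShort_assign_of_three {T C : CNFTheory A} {L : Finset (Literal A)} {l : Literal A}
    (hC : C ⊆ T) (h3 : ∀ c ∈ C, c.card ≤ 3) (hl : ∀ c ∈ C, l ∈ c) (hlL : l.compl ∈ L)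
    (hd : ∀ c ∈ C, Disjoint c L) : HasShort C.card (assign T L) := by
  have hsub : ∀ c : Clause A, c \ L.image Literal.compl ⊆ c.erase l := fun c x hx => by
    obtain ⟨hx, hx'⟩ := Finset.mem_sdiff.1 hx
    refine Finset.mem_erase.2 ⟨?_, hx⟩
    rintro rfl
    exact hx' (mem_image_compl.2 hlL)
  have hcard : ∀ c ∈ C, (c.erase l).card ≤ 2 := fun c hc => by
    rw [Finset.card_erase_of_mem (hl c hc)]
    have := h3 c hc
    omega
  refine hasShort_assign_of_injOn hC hd (fun c hc => ?_) fun c hc c' hc' h h' => ?_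
  · exact (Finset.card_le_card (hsub c)).trans (hcard c hc)
  · have e1 := Finset.eq_of_subset_of_card_le (hsub c) (by rw [h]; exact hcard c hc)
    have e2 := Finset.eq_of_subset_of_card_le (hsub c') (by rw [← h', h]; exact hcard c' hc')
    rw [← Finset.insert_erase (hl c hc), ← Finset.insert_erase (hl c' hc'), ← e1, ← e2, h']

lemma card_sdiff_le_of_card_le_succ {N : ℕ} {V : Finset A} {L : Finset (Literal A)}
    (hV : V.card ≤ N + 1) (hL : L.Nonempty) (hLV : ∀ l ∈ L, l.atom ∈ V) :
    (V \ atomsOf L).card ≤ N := by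
  obtain ⟨l, hl⟩ := hL
  have : (V \ atomsOf L).card < V.card := by
    refine Finset.card_lt_card (Finset.ssubset_iff_subset_ne.2 ⟨Finset.sdiff_subset, fun h => ?_⟩)
    have := hLV l hl
    rw [← h] at this
    exact (Finset.mem_sdiff.1 this).2 (Finset.mem_image_of_mem _ hl)
  omega

/-- A branch of which nothing is known but the number of literals and the loss in the matching. -/
lemma RatioOn.of_bounded {N : ℕ} (hB : Bounded A N) {V : Finset A} {T K : CNFTheory A}
    (hV : V.card ≤ N + 1) (hT : Wf V T) (hK : IsMatching T K) {L : Finset (Literal A)} (m j : ℕ)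
    (hne : L.Nonempty) (hLV : ∀ l ∈ L, l.atom ∈ V)
    (h : (∀ l ∈ L, l.compl ∉ L) → m ≤ L.card ∧ K.card ≤ (untouched K L).card + j) :
    RatioOn V T K L (base⁻¹ ^ m * gain ^ j) := by
  have := RatioOn.of_assign (T := T) (K := K) (r := 1) m j zero_le_one hLV fun hL =>
    ⟨(h hL).1, (h hL).2, hB _ _ _ (card_sdiff_le_of_card_le_succ hV hne hLV) (hT.assign L)
      (hK.untouched L)⟩
  simpa using this

lemma RatioOn.of_shortBound {N e : ℕ} {r : ℝ} (hB : ShortBound A N e r) (hr : 0 ≤ r)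
    {V : Finset A} {T : CNFTheory A} (hT : Wf V T) {L : Finset (Literal A)}
    (hV : (V \ atomsOf L).card ≤ N) (m : ℕ) (hLV : ∀ l ∈ L, l.atom ∈ V)
    (h : (∀ l ∈ L, l.compl ∉ L) → m ≤ L.card) (hs : HasShort e (assign T L)) :
    RatioOn V T ∅ L (r * base⁻¹ ^ m) := by
  have := RatioOn.of_assign (T := T) (K := ∅) m 0 hr hLV fun hL =>
    ⟨h hL, by simp, by simpa [untouched] using hB _ _ hV (hT.assign L) hs⟩
  simpa using this

/-- A clause with at most one literal. -/
lemma Ratio.of_card_le_one {N : ℕ} (hB : Bounded A N) {V : Finset A} {T K : CNFTheory A}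
    (hV : V.card ≤ N + 1) (hT : Wf V T) (hK : IsMatching T K) {c : Clause A} (hc : c ∈ T)
    (h1 : c.card ≤ 1) : Ratio V T K (base⁻¹ * gain) := by
  rcases Finset.eq_empty_or_nonempty c with rfl | hne
  · refine Ratio.of_card_irr_eq_zero (by norm_num [base, gain]) ?_
    refine Finset.eq_empty_of_forall_notMem fun M hM => ?_
    obtain ⟨l, hl, -⟩ := (mem_irr.1 hM).2.1 _ hc
    simp at hl
  · obtain ⟨l, rfl⟩ := Finset.card_eq_one.1 (le_antisymm h1 (Finset.card_pos.2 hne))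
    have h := RatioOn.of_bounded hB hV hT hK (L := {l}) 1 1 (by simp)
      (by simpa using hT.atom_mem _ hc l (by simp))
      fun _ => ⟨by simp, hK.card_le (L' := {l}) fun c _ m hm hml => ⟨m, hm, hml⟩⟩
    simp only [pow_one] at h
    refine Ratio.of_cover_one (fun M hM m hm => ?_) h
    obtain rfl : m = l := by simpa using hm
    obtain ⟨x, hx, hxM⟩ := (mem_irr.1 hM).2.1 _ hc
    obtain rfl : x = m := by simpa using hx
    exact hxM

lemma Ratio.of_unit {N : ℕ} (hB : Bounded A N) {V : Finset A} {T : CNFTheory A}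
    (hV : V.card ≤ N) (hT : Wf V T) (h : ∃ c ∈ T, c.card ≤ 1) : Ratio V T ∅ (base⁻¹ * gain) := by
  obtain ⟨c, hc, h1⟩ := h
  exact Ratio.of_card_le_one hB (by omega) hT (IsMatching.empty T) hc h1

lemma shortBound_zero {N : ℕ} (hB : Bounded A N) : ShortBound A N 0 1 :=
  fun V T hV hT _ => hB V T ∅ hV hT (IsMatching.empty T)

/-- The literals that share a two-literal clause of `E` with `l`. -/
def leaves (E : CNFTheory A) (l : Literal A) : Finset (Literal A) :=
  (E.filter fun c => l ∈ c).biUnion fun c => c.erase l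

lemma mem_leaves {E : CNFTheory A} {l x : Literal A} :
    x ∈ leaves E l ↔ ∃ c ∈ E, l ∈ c ∧ x ∈ c ∧ x ≠ l := by
  simp only [leaves, Finset.mem_biUnion, Finset.mem_filter, Finset.mem_erase]
  tauto

lemma eq_pair_of_card_two {c : Clause A} (h : c.card = 2) {l x : Literal A} (hl : l ∈ c)
    (hx : x ∈ c) (hne : x ≠ l) : c = {l, x} := by
  symm
  refine Finset.eq_of_subset_of_card_le ?_ ?_
  · intro y hy
    simp only [Finset.mem_insert, Finset.mem_singleton] at hy
    rcases hy with rfl | rfl <;> assumption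
  · rw [h, Finset.card_pair hne.symm]

lemma card_leaves {E : CNFTheory A} (h2 : ∀ c ∈ E, c.card = 2) (l : Literal A) :
    (leaves E l).card = (E.filter fun c => l ∈ c).card := by
  unfold leaves
  rw [Finset.card_biUnion, Finset.sum_congr rfl (g := fun _ => 1), Finset.card_eq_sum_ones]
  · intro c hc
    obtain ⟨hc, hl⟩ := Finset.mem_filter.1 hc
    rw [Finset.card_erase_of_mem hl, h2 c hc]
  · intro c hc c' hc' hne
    obtain ⟨hc, hl⟩ := Finset.mem_filter.1 hc
    obtain ⟨hc', hl'⟩ := Finset.mem_filter.1 hc'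
    refine Finset.disjoint_left.2 fun x hx hx' => hne ?_
    rw [eq_pair_of_card_two (h2 c hc) hl (Finset.mem_of_mem_erase hx) (Finset.ne_of_mem_erase hx),
      eq_pair_of_card_two (h2 c' hc') hl' (Finset.mem_of_mem_erase hx')
        (Finset.ne_of_mem_erase hx)]

/-- Branching on a literal `l`: when it is false, all literals that share a two-literal clause with
it are true. -/
lemma ratio_star {N e₁ e₂ : ℕ} {r₁ r₂ : ℝ} (hB₁ : ShortBound A N e₁ r₁)
    (hB₂ : ShortBound A N e₂ r₂) (hr₁ : 0 ≤ r₁) (hr₂ : 0 ≤ r₂) {V : Finset A}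
    {T E : CNFTheory A} (hV : V.card ≤ N) (hT : Wf V T) (hE : E ⊆ T) (h2 : ∀ c ∈ E, c.card = 2)
    {l : Literal A} (hl : ∃ c ∈ E, l ∈ c) (h₁ : HasShort e₁ (assign T {l}))
    (h₂ : HasShort e₂ (assign T (insert l.compl (leaves E l)))) :
    Ratio V T ∅
      (r₁ * base⁻¹ + r₂ * base⁻¹ ^ ((E.filter fun c => l ∈ c).card + 1)) := by
  have hlV : l.atom ∈ V := by
    obtain ⟨c, hc, hlc⟩ := hl
    exact hT.atom_mem c (hE hc) l hlc
  have hsub : ∀ L : Finset (Literal A), (V \ atomsOf L).card ≤ N := fun L =>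
    (Finset.card_le_card Finset.sdiff_subset).trans hV
  have b₁ := RatioOn.of_shortBound hB₁ hr₁ hT (hsub {l}) 1 (by simpa using hlV) (by simp) h₁
  have b₂ := RatioOn.of_shortBound hB₂ hr₂ hT (hsub _) ((E.filter fun c => l ∈ c).card + 1)
    (L := insert l.compl (leaves E l)) ?_ ?_ h₂
  · rw [pow_one] at b₁
    refine Ratio.of_cover_two (fun M hM => ?_) b₁ b₂
    by_cases hlM : l.Holds M
    · left; simpa using hlM
    · right
      intro x hx
      rcases Finset.mem_insert.1 hx with rfl | hx
      · rwa [Literal.holds_compl]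
      · obtain ⟨c, hc, hlc, hxc, hne⟩ := mem_leaves.1 hx
        obtain ⟨y, hy, hyM⟩ := (mem_irr.1 hM).2.1 c (hE hc)
        rw [eq_pair_of_card_two (h2 c hc) hlc hxc hne] at hy
        simp only [Finset.mem_insert, Finset.mem_singleton] at hy
        rcases hy with rfl | rfl
        · exact absurd hyM hlM
        · exact hyM
  · intro x hx
    rcases Finset.mem_insert.1 hx with rfl | hx
    · simpa using hlV
    · obtain ⟨c, hc, -, hxc, -⟩ := mem_leaves.1 hx
      exact hT.atom_mem c (hE hc) x hxc
  · intro _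
    rw [Finset.card_insert_of_notMem, card_leaves h2]
    intro hx
    obtain ⟨c, hc, hlc, hxc, -⟩ := mem_leaves.1 hx
    exact hT.compl_notMem c (hE hc) l hlc hxc

/-- `ratio_star` when only the number of two-literal clauses is known. -/
lemma ratio_star_of_le {N e : ℕ} {r : ℝ} (hB : Bounded A N) (hr : 0 ≤ r)
    (hS : ShortBound A N e r) {V : Finset A} {T E : CNFTheory A} (hV : V.card ≤ N) (hT : Wf V T)
    (hE : E ⊆ T) (h2 : ∀ c ∈ E, c.card = 2) {l : Literal A}
    (h0 : 0 < (E.filter fun c => l ∈ c).card) (he : (E.filter fun c => l ∈ c).card + e ≤ E.card) :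
    Ratio V T ∅ (r * base⁻¹ + base⁻¹ ^ ((E.filter fun c => l ∈ c).card + 1)) := by
  have hl : ∃ c ∈ E, l ∈ c := by
    obtain ⟨c, hc⟩ := Finset.card_pos.1 h0
    exact ⟨c, (Finset.mem_filter.1 hc).1, (Finset.mem_filter.1 hc).2⟩
  have hcard := Finset.card_filter_add_card_filter_not (s := E) fun c => l ∈ c
  have := ratio_star hS (shortBound_zero hB) hr zero_le_one hV hT hE h2 hl
    ((hasShort_assign_of_two (C := E.filter fun c => l ∉ c)
      ((Finset.filter_subset _ _).trans hE) (fun c hc => h2 c (Finset.mem_filter.1 hc).1)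
      (fun c hc => by simpa using (Finset.mem_filter.1 hc).2)).mono (by omega))
    (hasShort_zero _)
  simpa using this

/-- Two-literal clauses of which no two have a literal in common, although an atom may occur both
positively and negatively. -/
lemma ratio_of_degree_le_one {N e : ℕ} {r : ℝ} (hB : Bounded A N) (hr : 0 ≤ r)
    (hS : ShortBound A N e r) {V : Finset A} {T E : CNFTheory A} (hV : V.card ≤ N) (hT : Wf V T)
    (hE : E ⊆ T) (h2 : ∀ c ∈ E, c.card = 2) (he : e + 2 ≤ E.card)
    (hdeg : ∀ l, (E.filter fun c => l ∈ c).card ≤ 1) :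
    Ratio V T ∅ (max (2 * r * base⁻¹ ^ 2) (gain⁻¹ ^ E.card)) := by
  by_cases hcl : ∃ l, ∃ c ∈ E, ∃ c' ∈ E, l ∈ c ∧ l.compl ∈ c'
  · obtain ⟨l, c, hc, c', hc', hl, hl'⟩ := hcl
    have hsub : ∀ L : Finset (Literal A), (V \ atomsOf L).card ≤ N := fun L =>
      (Finset.card_le_card Finset.sdiff_subset).trans hV
    -- the two branches are symmetric under the exchange of `l` and its complement
    have branch : ∀ (l : Literal A) (c : Clause A), c ∈ E → l.compl ∈ c → l.atom ∈ V →
        RatioOn V T ∅ (insert l (c.erase l.compl)) (r * base⁻¹ ^ 2) := by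
      intro l c hc hl hlV
      obtain ⟨x, hx⟩ : ∃ x, c.erase l.compl = {x} :=
        Finset.card_eq_one.1 (by rw [Finset.card_erase_of_mem hl, h2 c hc])
      have hxc : x ∈ c := Finset.mem_of_mem_erase (hx ▸ Finset.mem_singleton_self x)
      have hlx : l ≠ x := by
        rintro rfl
        exact hT.compl_notMem c (hE hc) _ hxc hl
      rw [hx]
      refine RatioOn.of_shortBound hS hr hT (hsub _) 2 ?_ ?_ ?_
      · intro y hy
        simp only [Finset.mem_insert, Finset.mem_singleton] at hy
        rcases hy with rfl | rfl
        · exact hlV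
        · exact hT.atom_mem c (hE hc) _ hxc
      · intro _
        rw [Finset.card_pair hlx]
      · refine (hasShort_assign_of_two (C := E.filter fun c => Disjoint c {l, x})
          ((Finset.filter_subset _ _).trans hE) (fun c hc => h2 c (Finset.mem_filter.1 hc).1)
          (fun c hc => (Finset.mem_filter.1 hc).2)).mono ?_
        have hcov : E ⊆ (E.filter fun c => Disjoint c {l, x}) ∪
            ((E.filter fun c => l ∈ c) ∪ E.filter fun c => x ∈ c) := by
          intro d hd
          simp only [Finset.mem_union, Finset.mem_filter, Finset.disjoint_insert_right,
            Finset.disjoint_singleton_right, hd, true_and]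
          tauto
        have h3 := (Finset.card_le_card hcov).trans ((Finset.card_union_le _ _).trans
          (Nat.add_le_add_left (Finset.card_union_le _ _) _))
        have := hdeg l
        have := hdeg x
        omega
    have hlV := hT.atom_mem c (hE hc) l hl
    have b₁ := branch l c' hc' hl' hlV
    have b₂ := branch l.compl c hc (by simpa using hl) (by simpa using hlV)
    rw [Literal.compl_compl] at b₂
    refine (Ratio.of_cover_two (fun M hM => ?_) b₁ b₂).mono (le_max_of_le_left (by linarith))
    have hM := (mem_irr.1 hM).2.1
    by_cases hlM : l.Holds M
    · left
      intro x hx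
      rcases Finset.mem_insert.1 hx with rfl | hx
      · exact hlM
      · obtain ⟨y, hy, hyM⟩ := hM c' (hE hc')
        rw [eq_pair_of_card_two (h2 c' hc') hl' (Finset.mem_of_mem_erase hx)
          (Finset.ne_of_mem_erase hx)] at hy
        simp only [Finset.mem_insert, Finset.mem_singleton] at hy
        rcases hy with rfl | rfl
        · exact absurd hlM ((Literal.holds_compl M _).1 hyM)
        · exact hyM
    · right
      intro x hx
      rcases Finset.mem_insert.1 hx with rfl | hx
      · rwa [Literal.holds_compl]
      · obtain ⟨y, hy, hyM⟩ := hM c (hE hc)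
        rw [eq_pair_of_card_two (h2 c hc) hl (Finset.mem_of_mem_erase hx)
          (Finset.ne_of_mem_erase hx)] at hy
        simp only [Finset.mem_insert, Finset.mem_singleton] at hy
        rcases hy with rfl | rfl
        · exact absurd hyM hlM
        · exact hyM
  · push Not at hcl
    have hK : IsMatching T E := by
      refine ⟨hE, h2, fun c hc c' hc' l hl l' hl' h => ?_⟩
      rcases Literal.eq_or_eq_compl h with rfl | rfl
      · exact Finset.card_le_one.1 (hdeg l) c (by simp [hc, hl]) c' (by simp [hc', hl'])
      · exact absurd hl (hcl l' c' hc' c hc hl')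
    have h := hB V T E hV hT hK
    refine Ratio.mono ?_ (le_max_right _ _)
    unfold Ratio at h ⊢
    have hg := gain_pow_pos E.card
    rw [inv_pow, inv_mul_eq_div, le_div_iff₀ hg]
    simpa using h

lemma shortBound_of_card_eq {N e : ℕ} {r : ℝ} (hB : Bounded A N) (hr : base⁻¹ * gain ≤ r)
    (h : ∀ (V : Finset A) (T E : CNFTheory A), V.card ≤ N → Wf V T → E ⊆ T →
      (∀ c ∈ E, c.card = 2) → E.card = e → Ratio V T ∅ r) : ShortBound A N e r := by
  rintro V T hV hT (hu | ⟨E, hE, h2, he⟩)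
  · exact (Ratio.of_unit hB hV hT hu).mono hr
  · obtain ⟨E', hE', hc⟩ := Finset.exists_subset_card_eq he
    exact h V T E' hV hT (hE'.trans hE) (fun c hc => h2 c (hE' hc)) hc

lemma shortBound_one {N : ℕ} (hB : Bounded A N) : ShortBound A N 1 (10 / 11) := by
  refine shortBound_of_card_eq hB (by norm_num [base, gain]) fun V T E hV hT hE h2 he => ?_
  obtain ⟨c, rfl⟩ := Finset.card_eq_one.1 he
  have hK : IsMatching T {c} := ⟨hE, h2, by simp⟩
  have := hB V T {c} hV hT hK
  simp only [Ratio, Finset.card_singleton, Finset.card_empty, pow_one, pow_zero, mul_one, gain]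
    at this ⊢
  linarith

/-- The step from `e` to `e + 2` two-literal clauses. Either some literal lies in `d ≥ 2` of them, or
an atom occurs in them with both signs, or they form a matching. -/
lemma shortBound_step {N e : ℕ} {r r' : ℝ} (hB : Bounded A N) (hr : base⁻¹ * gain ≤ r)
    (hr' : 0 ≤ r') (hS : ShortBound A N e r')
    (hdeg : 2 * r' * base⁻¹ ^ 2 ≤ r) (hdis : gain⁻¹ ^ (e + 2) ≤ r)
    (hstar : ∀ d, 2 ≤ d → d ≤ e + 2 →
      ∃ r'', 0 ≤ r'' ∧ ShortBound A N (e + 2 - d) r'' ∧ r'' * base⁻¹ + base⁻¹ ^ (d + 1) ≤ r) :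
    ShortBound A N (e + 2) r := by
  refine shortBound_of_card_eq hB hr fun V T E hV hT hE h2 he => ?_
  by_cases hd : ∀ l, (E.filter fun c => l ∈ c).card ≤ 1
  · refine (ratio_of_degree_le_one hB hr' hS hV hT hE h2 he.ge hd).mono ?_
    rw [he]
    exact max_le hdeg hdis
  · push Not at hd
    obtain ⟨l, hl⟩ := hd
    have hle : (E.filter fun c => l ∈ c).card ≤ e + 2 := he ▸ Finset.card_filter_le _ _
    obtain ⟨r'', h0, hS', hle'⟩ := hstar _ hl hle
    exact (ratio_star_of_le hB h0 hS' hV hT hE h2 (l := l) (by omega) (by omega)).mono hle'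

lemma shortBound_two {N : ℕ} (hB : Bounded A N) : ShortBound A N 2 0.8265 := by
  refine shortBound_step (e := 0) hB (by norm_num [base, gain]) zero_le_one (shortBound_zero hB)
    (by norm_num [base]) (by norm_num [gain]) fun d h h' => ?_
  obtain rfl : d = 2 := by omega
  exact ⟨1, by norm_num, shortBound_zero hB, by norm_num [base]⟩

lemma shortBound_three {N : ℕ} (hB : Bounded A N) : ShortBound A N 3 0.7591 := by
  refine shortBound_step (e := 1) hB (by norm_num [base, gain]) (by norm_num) (shortBound_one hB)
    (by norm_num [base]) (by norm_num [gain]) fun d h h' => ?_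
  obtain rfl | rfl : d = 2 ∨ d = 3 := by omega
  · exact ⟨_, by norm_num, shortBound_one hB, by norm_num [base]⟩
  · exact ⟨1, by norm_num, shortBound_zero hB, by norm_num [base]⟩

lemma shortBound_four {N : ℕ} (hB : Bounded A N) : ShortBound A N 4 0.7097 := by
  refine shortBound_step (e := 2) hB (by norm_num [base, gain]) (by norm_num) (shortBound_two hB)
    (by norm_num [base]) (by norm_num [gain]) fun d h h' => ?_
  obtain rfl | rfl | rfl : d = 2 ∨ d = 3 ∨ d = 4 := by omega
  · exact ⟨_, by norm_num, shortBound_two hB, by norm_num [base]⟩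
  · exact ⟨_, by norm_num, shortBound_one hB, by norm_num [base]⟩
  · exact ⟨1, by norm_num, shortBound_zero hB, by norm_num [base]⟩

/-- Five two-literal clauses. A literal in three of them gives the bound at once. If the largest
number of clauses with a common literal `l` is two, then either a clause with the complement of `l`
becomes a unit when `l` is true, or some clause survives when `l` is false. -/
lemma shortBound_five {N : ℕ} (hB : Bounded A N) : ShortBound A N 5 0.6701 := by
  refine shortBound_of_card_eq hB (by norm_num [base, gain]) fun V T E hV hT hE h2 he => ?_
  by_cases hd : ∀ l, (E.filter fun c => l ∈ c).card ≤ 1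
  · refine (ratio_of_degree_le_one hB (by norm_num) (shortBound_three hB) hV hT hE h2 he.ge
      hd).mono ?_
    rw [he]
    norm_num [base, gain]
  by_cases h3 : ∃ l, 3 ≤ (E.filter fun c => l ∈ c).card
  · obtain ⟨l, hl⟩ := h3
    have hle : (E.filter fun c => l ∈ c).card ≤ 5 := he ▸ Finset.card_filter_le _ _
    obtain h | h | h : (E.filter fun c => l ∈ c).card = 3 ∨ (E.filter fun c => l ∈ c).card = 4 ∨
      (E.filter fun c => l ∈ c).card = 5 := by omega
    · have := ratio_star_of_le hB (by norm_num) (shortBound_two hB) hV hT hE h2 (l := l) (by omega)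
        (by omega)
      exact this.mono (by rw [h]; norm_num [base])
    · have := ratio_star_of_le hB (by norm_num) (shortBound_one hB) hV hT hE h2 (l := l) (by omega)
        (by omega)
      exact this.mono (by rw [h]; norm_num [base])
    · have := ratio_star_of_le hB (by norm_num) (shortBound_zero hB) hV hT hE h2 (l := l)
        (by omega) (by omega)
      exact this.mono (by rw [h]; norm_num [base])
  · push Not at hd h3
    obtain ⟨l, hl⟩ := hd
    have hl2 : (E.filter fun c => l ∈ c).card = 2 := by have := h3 l; omega
    have hlE : ∃ c ∈ E, l ∈ c := by
      obtain ⟨c, hc⟩ := Finset.card_pos.1 (by omega : 0 < (E.filter fun c => l ∈ c).card)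
      exact ⟨c, (Finset.mem_filter.1 hc).1, (Finset.mem_filter.1 hc).2⟩
    by_cases hcl : ∃ c ∈ E, l.compl ∈ c
    · have hu : HasShort 4 (assign T {l}) := by
        obtain ⟨c, hc, hcl⟩ := hcl
        refine Or.inl ⟨_, mem_assign.2 ⟨c, hE hc, ?_, rfl⟩, ?_⟩
        · rw [Finset.disjoint_singleton_right]
          exact fun h => hT.compl_notMem c (hE hc) l h hcl
        · rw [Finset.image_singleton, Finset.sdiff_singleton_eq_erase,
            Finset.card_erase_of_mem hcl, h2 c hc]
      refine (ratio_star (shortBound_four hB) (shortBound_zero hB) (by norm_num) (by norm_num) hV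
        hT hE h2 hlE hu (hasShort_zero _)).mono ?_
      rw [hl2]
      norm_num [base]
    · push Not at hcl
      have hcard := Finset.card_filter_add_card_filter_not (s := E) fun c => l ∈ c
      have h₁ : HasShort 3 (assign T {l}) :=
        (hasShort_assign_of_two (C := E.filter fun c => l ∉ c)
          ((Finset.filter_subset _ _).trans hE) (fun c hc => h2 c (Finset.mem_filter.1 hc).1)
          (fun c hc => by simpa using (Finset.mem_filter.1 hc).2)).mono (by omega)
      have h₂ : HasShort 1 (assign T (insert l.compl (leaves E l))) := by
        refine (hasShort_assign_of_two
          (C := E.filter fun c => Disjoint c (insert l.compl (leaves E l)))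
          ((Finset.filter_subset _ _).trans hE) (fun c hc => h2 c (Finset.mem_filter.1 hc).1)
          (fun c hc => (Finset.mem_filter.1 hc).2)).mono ?_
        have hcov : E ⊆ (E.filter fun c => Disjoint c (insert l.compl (leaves E l))) ∪
            (leaves E l).biUnion fun x => E.filter fun c => x ∈ c := by
          intro c hc
          by_cases hdis : Disjoint c (insert l.compl (leaves E l))
          · exact Finset.mem_union_left _ (Finset.mem_filter.2 ⟨hc, hdis⟩)
          · obtain ⟨x, hx, hx'⟩ := Finset.not_disjoint_iff.1 hdis
            rcases Finset.mem_insert.1 hx' with rfl | hx'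
            · exact absurd hx (hcl c hc)
            · exact Finset.mem_union_right _
                (Finset.mem_biUnion.2 ⟨x, hx', Finset.mem_filter.2 ⟨hc, hx⟩⟩)
        have h4 : ((leaves E l).biUnion fun x => E.filter fun c => x ∈ c).card ≤ 2 * 2 := by
          rw [← hl2, ← card_leaves h2 l]
          exact Finset.card_biUnion_le_card_mul _ _ _ fun x _ => by
            have := h3 x
            have h5 := card_leaves h2 l
            omega
        have h5 := (Finset.card_le_card hcov).trans (Finset.card_union_le _ _)
        omega
      refine (ratio_star (shortBound_three hB) (shortBound_one hB) (by norm_num) (by norm_num) hV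
        hT hE h2 hlE h₁ h₂).mono ?_
      rw [hl2]
      norm_num [base]

end Short

/-! ### Two-literal clauses beside a matching -/

section Extra

variable {A : Type*} [DecidableEq A]

lemma exists_eq_pair {c : Clause A} (h : c.card = 2) {l : Literal A} (hl : l ∈ c) :
    ∃ x, x ≠ l ∧ c = {l, x} := by
  obtain ⟨x, hx⟩ := Finset.card_eq_one.1 (by rw [Finset.card_erase_of_mem hl, h] :
    (c.erase l).card = 1)
  have hxc : x ∈ c.erase l := hx ▸ Finset.mem_singleton_self x
  exact ⟨x, Finset.ne_of_mem_erase hxc, eq_pair_of_card_two h hl (Finset.mem_of_mem_erase hxc)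
    (Finset.ne_of_mem_erase hxc)⟩

omit [DecidableEq A] in
lemma Wf.ne_compl {V : Finset A} {T : CNFTheory A} (h : Wf V T) {c : Clause A} (hc : c ∈ T)
    {l x : Literal A} (hl : l ∈ c) (hx : x ∈ c) : x ≠ l.compl := by
  rintro rfl
  exact h.compl_notMem c hc l hl hx

lemma Irredundant.holds_of_pair {T : CNFTheory A} {M : Finset A} (h : Irredundant T M)
    {l x : Literal A} (hc : {l, x} ∈ T) (hl : ¬ l.Holds M) : x.Holds M := by
  obtain ⟨y, hy, hyM⟩ := h.1 _ hc
  simp only [Finset.mem_insert, Finset.mem_singleton] at hy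
  rcases hy with rfl | rfl
  · exact absurd hyM hl
  · exact hyM

lemma mem_assign_of_untouched {T : CNFTheory A} {L : Finset (Literal A)} {c : Clause A}
    (hc : c ∈ T) (h : ∀ l ∈ c, l ∉ L ∧ l.compl ∉ L) : c ∈ assign T L := by
  refine mem_assign.2 ⟨c, hc, Finset.disjoint_left.2 fun l hl => (h l hl).1, ?_⟩
  refine Finset.sdiff_eq_self_of_disjoint (Finset.disjoint_left.2 fun l hl hl' => ?_)
  exact (h l hl).2 (mem_image_compl.1 hl')

/-- Two clauses `l ∨ d` and `l ∨ x`, the first of them in the matching. -/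
lemma ratio_of_common {N : ℕ} {r : ℝ} (hB : Bounded A N) (hr : 0 ≤ r) {V : Finset A}
    {T K : CNFTheory A} (hV : V.card ≤ N + 1) (hT : Wf V T) (hK : IsMatching T K)
    {l d x : Literal A} (hd : {l, d} ∈ K) (hx : {l, x} ∈ T) (hxd : x ≠ d)
    (h : Ratio (V \ atomsOf {l}) (assign T {l}) (untouched K {l}) r) :
    Ratio V T K (r * base⁻¹ * gain + base⁻¹ ^ 3 * gain ^ 2) := by
  have hlV := hT.atom_mem _ hx l (by simp)
  have b₁ : RatioOn V T K {l} (r * base⁻¹ ^ 1 * gain ^ 1) :=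
    RatioOn.of_assign 1 1 hr (by simpa using hlV) fun _ =>
      ⟨by simp, hK.card_le (L' := {l}) fun c _ m hm hml => ⟨m, hm, hml⟩, h⟩
  have b₂ : RatioOn V T K {l.compl, x, d} (base⁻¹ ^ 3 * gain ^ 2) := by
    refine RatioOn.of_bounded hB hV hT hK 3 2 (by simp) ?_ fun _ => ⟨?_, ?_⟩
    · intro y hy
      simp only [Finset.mem_insert, Finset.mem_singleton] at hy
      rcases hy with rfl | rfl | rfl
      · simpa using hlV
      · exact hT.atom_mem _ hx _ (by simp)
      · exact hT.atom_mem _ (hK.subset hd) _ (by simp)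
    · have h1 := hT.ne_compl hx (l := l) (x := x) (by simp) (by simp)
      have h2 := hT.ne_compl (hK.subset hd) (l := l) (x := d) (by simp) (by simp)
      rw [Finset.card_eq_three.2 ⟨_, _, _, h1.symm, h2.symm, hxd, rfl⟩]
    · refine (hK.card_le (L' := {l, x}) fun c hc m hm hmL => ?_).trans
        (Nat.add_le_add_left Finset.card_le_two _)
      simp only [Finset.mem_image, Finset.mem_insert, Finset.mem_singleton] at hmL
      obtain ⟨y, rfl | rfl | rfl, hy⟩ := hmL
      · exact ⟨m, hm, by simpa using Or.inl hy.symm⟩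
      · exact ⟨m, hm, by simpa using Or.inr hy.symm⟩
      · -- the clause of the matching that contains `d` contains `l` as well
        have := hK.eq_of_atom c hc _ hd m hm y (by simp) hy.symm
        exact ⟨l, by simp [this], by simp⟩
  simp only [pow_one] at b₁
  refine Ratio.of_cover_two (fun M hM => ?_) b₁ b₂
  have hM := (mem_irr.1 hM).2
  by_cases hl : l.Holds M
  · left; simpa using hl
  · right
    simp only [Finset.mem_insert, Finset.mem_singleton, forall_eq_or_imp, forall_eq]
    exact ⟨(Literal.holds_compl M l).2 hl, hM.holds_of_pair hx hl,
      hM.holds_of_pair (hK.subset hd) hl⟩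

/-- Two clauses `l ∨ d` and `¬l ∨ x`, the first of them in the matching. -/
lemma ratio_of_clash {N : ℕ} (hB : Bounded A N) {V : Finset A}
    {T K : CNFTheory A} (hV : V.card ≤ N + 1) (hT : Wf V T) (hK : IsMatching T K)
    {l d x : Literal A} (hd : {l, d} ∈ K) (hx : {l.compl, x} ∈ T) : Ratio V T K (base⁻¹ ^ 2 * gain + base⁻¹ ^ 2 * gain ^ 2) := by
  have hlV := hT.atom_mem _ (hK.subset hd) l (by simp)
  have hdV := hT.atom_mem _ (hK.subset hd) d (by simp)
  have hxV := hT.atom_mem _ hx x (by simp)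
  have b₁ : RatioOn V T K {l, x} (base⁻¹ ^ 2 * gain ^ 2) := by
    refine RatioOn.of_bounded hB hV hT hK 2 2 (by simp) (by simp [hlV, hxV]) fun _ => ⟨?_, ?_⟩
    · have := hT.ne_compl hx (l := l.compl) (x := x) (by simp) (by simp)
      rw [Literal.compl_compl] at this
      rw [Finset.card_pair this.symm]
    · exact (hK.card_le fun c _ m hm hml => ⟨m, hm, hml⟩).trans
        (Nat.add_le_add_left Finset.card_le_two _)
  have b₂ : RatioOn V T K {l.compl, d} (base⁻¹ ^ 2 * gain ^ 1) := by
    refine RatioOn.of_bounded hB hV hT hK 2 1 (by simp) (by simp [hlV, hdV]) fun _ => ⟨?_, ?_⟩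
    · rw [Finset.card_pair (hT.ne_compl (hK.subset hd) (by simp) (by simp)).symm]
    · refine hK.card_le (L' := {l}) fun c hc m hm hmL => ?_
      simp only [Finset.mem_image, Finset.mem_insert, Finset.mem_singleton] at hmL
      obtain ⟨y, rfl | rfl, hy⟩ := hmL
      · exact ⟨m, hm, by simpa using hy.symm⟩
      · have := hK.eq_of_atom c hc _ hd m hm y (by simp) hy.symm
        exact ⟨l, by simp [this], by simp⟩
  rw [pow_one] at b₂
  rw [add_comm]
  refine Ratio.of_cover_two (fun M hM => ?_) b₁ b₂
  have hM := (mem_irr.1 hM).2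
  by_cases hl : l.Holds M
  · left
    simp only [Finset.mem_insert, Finset.mem_singleton, forall_eq_or_imp, forall_eq]
    exact ⟨hl, hM.holds_of_pair hx (by rwa [Literal.holds_compl, not_not])⟩
  · right
    simp only [Finset.mem_insert, Finset.mem_singleton, forall_eq_or_imp, forall_eq]
    exact ⟨(Literal.holds_compl M l).2 hl, hM.holds_of_pair (hK.subset hd) hl⟩

/-- A two-literal clause outside the matching that has an atom in common with it. -/
lemma ratio_of_touching {N : ℕ} (hB : Bounded A N) {V : Finset A} {T K : CNFTheory A}
    (hV : V.card ≤ N + 1) (hT : Wf V T) (hK : IsMatching T K) {c k : Clause A} (hc : c ∈ T)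
    (h2 : c.card = 2) (hcK : c ∉ K) (hk : k ∈ K) {l m : Literal A} (hl : l ∈ c) (hm : m ∈ k)
    (hlm : l.atom = m.atom) : Ratio V T K 0.9184 := by
  obtain ⟨d, hd, rfl⟩ := exists_eq_pair (hK.card_eq k hk) hm
  obtain ⟨x, hx, rfl⟩ := exists_eq_pair h2 hl
  rcases Literal.eq_or_eq_compl hlm with rfl | rfl
  · have hxd : x ≠ d := by rintro rfl; exact hcK hk
    refine (ratio_of_common hB zero_le_one hV hT hK hk hc hxd ?_).mono (by norm_num [base, gain])
    exact hB _ _ _ (card_sdiff_le_of_card_le_succ hV (by simp)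
      (by simpa using hT.atom_mem _ hc l (by simp))) (hT.assign _) (hK.untouched _)
  · exact (ratio_of_clash hB hV hT hK hk hc).mono (by norm_num [base, gain])

lemma IsMatching.insert {T K : CNFTheory A} (hK : IsMatching T K)
    {c : Clause A} (hc : c ∈ T) (h2 : c.card = 2)
    (h : ∀ k ∈ K, ∀ l ∈ c, ∀ m ∈ k, l.atom ≠ m.atom) : IsMatching T (insert c K) := by
  refine ⟨Finset.insert_subset hc hK.subset, ?_, ?_⟩
  · intro d hd
    rcases Finset.mem_insert.1 hd with rfl | hd
    · exact h2
    · exact hK.card_eq d hd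
  · intro d hd d' hd' l hl l' hl' hll
    rcases Finset.mem_insert.1 hd with hd | hd <;> rcases Finset.mem_insert.1 hd' with hd' | hd'
    · rw [hd, hd']
    · exact absurd hll (h d' hd' l (hd ▸ hl) l' hl')
    · exact absurd hll.symm (h d hd l' (hd' ▸ hl') l hl)
    · exact hK.eq_of_atom d hd d' hd' l hl l' hl' hll

/-- A bound with respect to a larger matching is better by the factor `gain`. -/
lemma Ratio.of_insert {V : Finset A} {T K : CNFTheory A} {c : Clause A} {r : ℝ} (hc : c ∉ K)
    (h : Ratio V T (insert c K) r) : Ratio V T K (r * (10 / 11)) := by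
  unfold Ratio at h ⊢
  rw [Finset.card_insert_of_notMem hc, pow_succ] at h
  have : gain = 11 / 10 := rfl
  rw [this] at h ⊢
  linarith

/-- One two-literal clause outside the matching. -/
lemma ratio_of_extra {N : ℕ} (hB : Bounded A N) {V : Finset A} {T K : CNFTheory A}
    (hV : V.card ≤ N) (hT : Wf V T) (hK : IsMatching T K) {c : Clause A} (hc : c ∈ T)
    (h2 : c.card = 2) (hcK : c ∉ K) : Ratio V T K 0.9184 := by
  by_cases h : ∀ k ∈ K, ∀ l ∈ c, ∀ m ∈ k, l.atom ≠ m.atom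
  · exact (Ratio.of_insert hcK (hB V T _ hV hT (hK.insert hc h2 h))).mono (by norm_num)
  · push Not at h
    obtain ⟨k, hk, l, hl, m, hm, hlm⟩ := h
    exact ratio_of_touching hB (by omega) hT hK hc h2 hcK hk hl hm hlm

/-- Two two-literal clauses outside the matching. -/
lemma ratio_of_two_extra {N : ℕ} (hB : Bounded A N) {V : Finset A} {T K : CNFTheory A}
    (hV : V.card ≤ N) (hT : Wf V T) (hK : IsMatching T K) {c c' : Clause A} (hc : c ∈ T)
    (h2 : c.card = 2) (hcK : c ∉ K) (hc' : c' ∈ T) (h2' : c'.card = 2) (hcK' : c' ∉ K)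
    (hne : c ≠ c') : Ratio V T K 0.8647 := by
  by_cases h : ∀ k ∈ K, ∀ l ∈ c, ∀ m ∈ k, l.atom ≠ m.atom
  · refine (Ratio.of_insert hcK (ratio_of_extra hB hV hT (hK.insert hc h2 h) hc' h2' ?_)).mono
      (by norm_num)
    simp [hne.symm, hcK']
  push Not at h
  obtain ⟨k, hk, l, hl, m, hm, hlm⟩ := h
  obtain ⟨d, hd, rfl⟩ := exists_eq_pair (hK.card_eq k hk) hm
  obtain ⟨x, hx, rfl⟩ := exists_eq_pair h2 hl
  rcases (Literal.eq_or_eq_compl hlm).symm with rfl | rfl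
  · exact (ratio_of_clash hB (by omega) hT hK hk hc).mono (by norm_num [base, gain])
  have hxd : x ≠ d := by rintro rfl; exact hcK hk
  have hlV := hT.atom_mem _ hc l (by simp)
  by_cases hl' : l.compl ∈ c'
  · obtain ⟨y, hy, rfl⟩ := exists_eq_pair h2' hl'
    exact (ratio_of_clash hB (by omega) hT hK hk hc').mono (by norm_num [base, gain])
  by_cases hl'' : l ∈ c'
  · obtain ⟨y, hy, rfl⟩ := exists_eq_pair h2' hl''
    have hyd : y ≠ d := by rintro rfl; exact hcK' hk
    have hxy : x ≠ y := by rintro rfl; exact hne rfl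
    have hxV := hT.atom_mem _ hc x (by simp)
    have hyV := hT.atom_mem _ hc' y (by simp)
    have hdV := hT.atom_mem _ (hK.subset hk) d (by simp)
    have b₁ : RatioOn V T K {l} (base⁻¹ ^ 1 * gain ^ 1) :=
      RatioOn.of_bounded hB (by omega) hT hK 1 1 (by simp) (by simpa using hlV) fun _ =>
        ⟨by simp, hK.card_le (L' := {l}) fun c _ m hm hml => ⟨m, hm, hml⟩⟩
    have b₂ : RatioOn V T K {l.compl, x, y, d} (base⁻¹ ^ 4 * gain ^ 3) := by
      refine RatioOn.of_bounded hB (by omega) hT hK 4 3 (by simp) ?_ fun _ => ⟨?_, ?_⟩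
      · simp [hlV, hxV, hyV, hdV]
      · have h1 := (hT.ne_compl hc (l := l) (x := x) (by simp) (by simp)).symm
        have h2 := (hT.ne_compl hc' (l := l) (x := y) (by simp) (by simp)).symm
        have h3 := (hT.ne_compl (hK.subset hk) (l := l) (x := d) (by simp) (by simp)).symm
        rw [Finset.card_insert_of_notMem (by simp [h1, h2, h3]),
          Finset.card_eq_three.2 ⟨_, _, _, hxy, hxd, hyd, rfl⟩]
      · refine (hK.card_le (L' := {l, x, y}) fun b hb w hw hmL => ?_).trans
          (Nat.add_le_add_left Finset.card_le_three _)
        simp only [Finset.mem_image, Finset.mem_insert, Finset.mem_singleton] at hmL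
        obtain ⟨z, rfl | rfl | rfl | rfl, hz⟩ := hmL
        · exact ⟨w, hw, by simpa using Or.inl hz.symm⟩
        · exact ⟨w, hw, by simpa using Or.inr (Or.inl hz.symm)⟩
        · exact ⟨w, hw, by simpa using Or.inr (Or.inr hz.symm)⟩
        · have := hK.eq_of_atom b hb _ hk w hw z (by simp) hz.symm
          exact ⟨l, by simp [this], by simp⟩
    refine (Ratio.of_cover_two (fun M hM => ?_) b₁ b₂).mono (by norm_num [base, gain])
    have hM := (mem_irr.1 hM).2
    by_cases hlM : l.Holds M
    · left; simpa using hlM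
    · right
      simp only [Finset.mem_insert, Finset.mem_singleton, forall_eq_or_imp, forall_eq]
      exact ⟨(Literal.holds_compl M l).2 hlM, hM.holds_of_pair hc hlM,
        hM.holds_of_pair hc' hlM, hM.holds_of_pair (hK.subset hk) hlM⟩
  · refine (ratio_of_common hB (r := 0.9184) (by norm_num) (by omega) hT hK hk hc hxd ?_).mono
      (by norm_num [base, gain])
    refine ratio_of_extra hB ((Finset.card_le_card Finset.sdiff_subset).trans hV) (hT.assign _)
      (hK.untouched _) (mem_assign_of_untouched hc' fun y hy => ?_) h2'
      fun h => hcK' (Finset.mem_filter.1 h).1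
    simp only [Finset.mem_singleton]
    refine ⟨?_, ?_⟩
    · rintro rfl; exact hl'' hy
    · rintro rfl; exact hl' (by simpa using hy)

end Extra

/-! ### Theories with two-literal clauses -/

section Main

variable {A : Type*} [DecidableEq A]

/-- The normal form in which a theory with a matching `K` is branched on. -/
structure Reduced (V : Finset A) (T K : CNFTheory A) : Prop where
  wf : Wf V T
  matching : IsMatching T K
  two_le : ∀ c ∈ T, 2 ≤ c.card
  mem_of_card : ∀ c ∈ T, c.card = 2 → c ∈ K
  eq_of_subset : ∀ c ∈ T, ∀ c' ∈ T, c ⊆ c' → c = c'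

omit [DecidableEq A] in
/-- A clause of a reduced theory that has an atom in common with the matching, but does not belong
to it, has three literals. -/
lemma Reduced.card_eq_three {V : Finset A} {T K : CNFTheory A} (h : Reduced V T K) {c k : Clause A}
    (hc : c ∈ T) (hk : k ∈ K) {l m : Literal A} (hl : l ∈ c) (hm : m ∈ k) (hlm : l.atom = m.atom)
    (hne : c ≠ k) : c.card = 3 := by
  have h1 := h.wf.card_le c hc
  have h2 := h.two_le c hc
  have h3 : c.card ≠ 2 := fun h2 =>
    hne (h.matching.eq_of_atom c (h.mem_of_card c hc h2) k hk l hl m hm hlm)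
  omega

/-- A three-literal clause becomes a two-literal clause outside the matching when one of its
literals becomes false and the two others are not affected. -/
lemma Reduced.erase_extra {V : Finset A} {T K : CNFTheory A} (h : Reduced V T K) {c : Clause A}
    (hc : c ∈ T) (h3 : c.card = 3) {l : Literal A} (hl : l ∈ c) {L : Finset (Literal A)}
    (hlL : l.compl ∈ L) (hd : Disjoint c L) (hn : ∀ x ∈ c, x ≠ l → x.compl ∉ L) :
    c.erase l ∈ assign T L ∧ (c.erase l).card = 2 ∧ c.erase l ∉ untouched K L := by
  refine ⟨mem_assign.2 ⟨c, hc, hd, ?_⟩, by rw [Finset.card_erase_of_mem hl, h3], fun hmem => ?_⟩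
  · ext x
    simp only [Finset.mem_sdiff, mem_image_compl, Finset.mem_erase]
    constructor
    · rintro ⟨hx, hxL⟩
      exact ⟨fun h => hxL (h ▸ hlL), hx⟩
    · rintro ⟨hne, hx⟩
      exact ⟨hx, hn x hx hne⟩
  · have := h.eq_of_subset _ (h.matching.subset (Finset.mem_filter.1 hmem).1) c hc
      (Finset.erase_subset _ _)
    rw [← this] at hl
    exact Finset.notMem_erase l c hl

/-- A clause `¬a ∨ d` of the matching: when `a` is false, a clause with `a` becomes an additional
two-literal clause. -/
lemma Reduced.ratio_of_neg {N : ℕ} (hB : Bounded A N) {V : Finset A} {T K : CNFTheory A}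
    (hV : V.card ≤ N + 1) (h : Reduced V T K) {a : A} {d : Literal A} (hk : {.neg a, d} ∈ K) :
    Ratio V T K 1 := by
  have hkT := h.matching.subset hk
  have haV : a ∈ V := h.wf.atom_mem _ hkT (.neg a) (by simp)
  have hdV := h.wf.atom_mem _ hkT d (by simp)
  have hN : (V \ atomsOf {Literal.neg a}).card ≤ N :=
    card_sdiff_le_of_card_le_succ hV (by simp) (by simpa [Literal.atom] using haV)
  have hj : K.card ≤ (untouched K {Literal.neg a}).card + 1 :=
    h.matching.card_le (L' := {Literal.neg a}) fun c _ m hm hml => ⟨m, hm, hml⟩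
  by_cases hp : ∃ c ∈ T, Literal.pos a ∈ c
  · obtain ⟨c, hc, hac⟩ := hp
    have h3 : c.card = 3 := by
      refine h.card_eq_three hc hk (l := .pos a) (m := .neg a) hac (by simp) rfl ?_
      rintro rfl
      exact h.wf.compl_notMem _ hc (.pos a) hac (by simp [Literal.compl])
    obtain ⟨e1, e2, e3⟩ := h.erase_extra hc h3 hac (L := {.neg a}) (by simp [Literal.compl])
      (by
        rw [Finset.disjoint_singleton_right]
        exact h.wf.compl_notMem c hc _ hac)
      (fun x hx hne hx' => hne (by
        rw [Finset.mem_singleton] at hx'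
        cases x <;> simp_all [Literal.compl]))
    have b₁ : RatioOn V T K {.neg a} (0.9184 * base⁻¹ ^ 1 * gain ^ 1) :=
      RatioOn.of_assign 1 1 (by norm_num) (by simpa [Literal.atom] using haV) fun _ =>
        ⟨by simp, hj, ratio_of_extra hB hN (h.wf.assign _) (h.matching.untouched _) e1 e2 e3⟩
    have b₂ : RatioOn V T K {.pos a, d} (base⁻¹ ^ 2 * gain ^ 1) := by
      refine RatioOn.of_bounded hB hV h.wf h.matching 2 1 (by simp)
        (by
          simp only [Finset.mem_insert, Finset.mem_singleton, forall_eq_or_imp, forall_eq]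
          exact ⟨haV, hdV⟩) fun _ => ⟨?_, ?_⟩
      · have : d ≠ .pos a := h.wf.ne_compl hkT (l := .neg a) (x := d) (by simp) (by simp)
        rw [Finset.card_pair this.symm]
      · refine h.matching.card_le (L' := {.neg a}) fun c hc m hm hmL => ?_
        simp only [Finset.mem_image, Finset.mem_insert, Finset.mem_singleton] at hmL
        obtain ⟨y, rfl | rfl, hy⟩ := hmL
        · exact ⟨m, hm, by simpa [Literal.atom] using hy.symm⟩
        · have := h.matching.eq_of_atom c hc _ hk m hm y (by simp) hy.symm
          exact ⟨.neg a, by simp [this], by simp⟩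
    refine (Ratio.of_cover_two (fun M hM => ?_) b₁ b₂).mono (by norm_num [base, gain])
    have hM := (mem_irr.1 hM).2
    by_cases ha : a ∈ M
    · right
      simp only [Finset.mem_insert, Finset.mem_singleton, forall_eq_or_imp, forall_eq]
      exact ⟨ha, hM.holds_of_pair hkT (by simpa [Literal.Holds] using ha)⟩
    · left
      simpa [Literal.Holds] using ha
  · have b : RatioOn V T K {.neg a} (base⁻¹ ^ 1 * gain ^ 1) :=
      RatioOn.of_bounded hB hV h.wf h.matching 1 1 (by simp)
        (by simpa [Literal.atom] using haV) fun _ => ⟨by simp, hj⟩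
    refine (Ratio.of_cover_one (fun M hM => ?_) b).mono (by norm_num [base, gain])
    simp only [Finset.mem_singleton, forall_eq]
    intro ha
    obtain ⟨c, hc, hac, -⟩ := (mem_irr.1 hM).2.exists_critical ha
    exact hp ⟨c, hc, hac⟩

set_option maxHeartbeats 400000 in
/-- A clause `a ∨ b` of the matching. When `a` and `b` are both true, `a` needs a further clause
without `b`; when `a` is false, two such clauses become additional two-literal clauses. -/
lemma Reduced.ratio_of_pos {N : ℕ} (hB : Bounded A N) {V : Finset A} {T K : CNFTheory A}
    (hV : V.card ≤ N + 1) (h : Reduced V T K) {a b : A} (hk : {.pos a, .pos b} ∈ K) (hab : a ≠ b) :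
    Ratio V T K 1 := by
  have hkT := h.matching.subset hk
  have haV : a ∈ V := h.wf.atom_mem _ hkT (.pos a) (by simp)
  have hbV : b ∈ V := h.wf.atom_mem _ hkT (.pos b) (by simp)
  have hN : (V \ atomsOf {.neg a, .pos b}).card ≤ N :=
    card_sdiff_le_of_card_le_succ hV (by simp) (by simp [Literal.atom, haV, hbV])
  -- an assignment to `a` and `b` destroys the clause `a ∨ b` of the matching only
  have hj : ∀ L : Finset (Literal A), atomsOf L ⊆ {a, b} →
      K.card ≤ (untouched K L).card + 1 := fun L hL =>
    h.matching.card_le (L' := {.pos a}) fun c hc m hm hmL => by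
      have := hL hmL
      simp only [Finset.mem_insert, Finset.mem_singleton] at this
      rcases this with hy | hy
      · exact ⟨m, hm, by simpa [Literal.atom] using hy⟩
      · have := h.matching.eq_of_atom c hc _ hk m hm (.pos b) (by simp) hy
        exact ⟨.pos a, by simp [this], by simp⟩
  have hcov : ∀ M ∈ irr V T, a ∉ M → b ∈ M := fun M hM ha =>
    (mem_irr.1 hM).2.holds_of_pair hkT (by simpa [Literal.Holds] using ha)
  have three : ∀ c ∈ T, Literal.pos a ∈ c → Literal.pos b ∉ c → c.card = 3 := by
    intro c hc hac hbc
    refine h.card_eq_three hc hk (l := .pos a) (m := .pos a) hac (by simp) rfl ?_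
    rintro rfl
    simp at hbc
  have ba : RatioOn V T K {.pos a} (base⁻¹ ^ 1 * gain ^ 1) :=
    RatioOn.of_bounded hB hV h.wf h.matching 1 1 (by simp) (by simpa [Literal.atom] using haV)
      fun _ => ⟨by simp, hj _ (by simp [Literal.atom])⟩
  have bnab : ∀ r : ℝ, 0 ≤ r → Ratio (V \ atomsOf {.neg a, .pos b})
      (assign T {.neg a, .pos b}) (untouched K {.neg a, .pos b}) r →
      RatioOn V T K {.neg a, .pos b} (r * base⁻¹ ^ 2 * gain ^ 1) := fun r hr hR =>
    RatioOn.of_assign 2 1 hr (by simp [Literal.atom, haV, hbV]) fun _ =>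
      ⟨by simp, hj _ (by simp [Literal.atom]), hR⟩
  by_cases hcl : ∃ c ∈ T, Literal.pos a ∈ c ∧ Literal.neg b ∈ c
  · obtain ⟨c, hc, hac, hbc⟩ := hcl
    have hbc' : Literal.pos b ∉ c := h.wf.compl_notMem c hc _ hbc
    have hna : Literal.neg a ∉ c := h.wf.compl_notMem c hc _ hac
    have h3 := three c hc hac hbc'
    have hu : (c \ ({.neg a, .pos b} : Finset (Literal A)).image Literal.compl).card ≤ 1 := by
      have : c \ ({.neg a, .pos b} : Finset (Literal A)).image Literal.compl =
          c \ {.pos a, .neg b} := by simp [Finset.image_insert, Literal.compl]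
      rw [this, Finset.card_sdiff_of_subset (by simp [Finset.insert_subset_iff, hac, hbc]), h3,
        Finset.card_pair (by simp)]
    have hR := Ratio.of_card_le_one hB (by omega) (h.wf.assign _)
      (h.matching.untouched {.neg a, .pos b})
      (mem_assign.2 ⟨c, hc, by simp [hna, hbc'], rfl⟩) hu
    refine (Ratio.of_cover_two (fun M hM => ?_) ba
      (bnab _ (by norm_num [base, gain]) hR)).mono (by norm_num [base, gain])
    by_cases ha : a ∈ M
    · left; simpa [Literal.Holds] using ha
    · right; simpa [Literal.Holds, ha] using hcov M hM ha
  push Not at hcl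
  set P := T.filter fun c => Literal.pos a ∈ c ∧ Literal.pos b ∉ c with hP
  have hcrit : ∀ M ∈ irr V T, a ∈ M → b ∈ M →
      ∃ c ∈ P, ∀ l ∈ c, l ≠ .pos a → ¬ l.Holds M := by
    intro M hM ha hb
    obtain ⟨c, hc, hac, hf⟩ := (mem_irr.1 hM).2.exists_critical ha
    refine ⟨c, Finset.mem_filter.2 ⟨hc, hac, fun hbc => ?_⟩, hf⟩
    exact hf _ hbc (by simpa using hab.symm) hb
  have banb : RatioOn V T K {.pos a, .neg b} (base⁻¹ ^ 2 * gain ^ 1) :=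
    RatioOn.of_bounded hB hV h.wf h.matching 2 1 (by simp) (by simp [Literal.atom, haV, hbV])
      fun _ => ⟨by simp, hj _ (by simp [Literal.atom])⟩
  have bnab1 := bnab 1 zero_le_one (hB _ _ _ hN (h.wf.assign _) (h.matching.untouched _))
  obtain hc0 | hc1 | hc2 : P.card = 0 ∨ P.card = 1 ∨ 1 < P.card := by omega
  · refine (Ratio.of_cover_two (fun M hM => ?_) banb bnab1).mono (by norm_num [base, gain])
    by_cases ha : a ∈ M
    · left
      have hb : b ∉ M := fun hb => by
        obtain ⟨c, hc, -⟩ := hcrit M hM ha hb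
        rw [Finset.card_eq_zero.1 hc0] at hc
        simp at hc
      simp [Literal.Holds, ha, hb]
    · right; simpa [Literal.Holds, ha] using hcov M hM ha
  · obtain ⟨c, hc⟩ := Finset.card_eq_one.1 hc1
    have hcP : c ∈ P := by simp [hc]
    obtain ⟨hcT, hac, hbc⟩ := Finset.mem_filter.1 hcP
    have h3 := three c hcT hac hbc
    have hnb := hcl c hcT hac
    set L : Finset (Literal A) := insert (.pos a) (insert (.pos b)
      ((c.erase (.pos a)).image Literal.compl)) with hL
    have hcompl : ((c.erase (.pos a)).image Literal.compl).card = 2 := by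
      rw [Finset.card_image_of_injective, Finset.card_erase_of_mem hac, h3]
      exact fun x y hxy => by simpa using congrArg Literal.compl hxy
    have bL : RatioOn V T K L (base⁻¹ ^ 4 * gain ^ 3) := by
      refine RatioOn.of_bounded hB hV h.wf h.matching 4 3 (by simp [hL]) ?_ fun _ => ⟨?_, ?_⟩
      · intro x hx
        rcases Finset.mem_insert.1 hx with rfl | hx
        · exact haV
        rcases Finset.mem_insert.1 hx with rfl | hx
        · exact hbV
        · obtain ⟨y, hy, rfl⟩ := Finset.mem_image.1 hx
          simpa using h.wf.atom_mem c hcT y (Finset.mem_of_mem_erase hy)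
      · have h1 : Literal.pos b ∉ (c.erase (.pos a)).image Literal.compl := by
          rw [mem_image_compl]
          exact fun hm => hnb (Finset.mem_of_mem_erase hm)
        have h2 : Literal.pos a ∉ insert (.pos b) ((c.erase (.pos a)).image Literal.compl) := by
          rw [Finset.mem_insert, mem_image_compl]
          rintro (hm | hm)
          · exact hab (by simpa using hm)
          · exact h.wf.compl_notMem c hcT _ hac (Finset.mem_of_mem_erase hm)
        rw [hL, Finset.card_insert_of_notMem h2, Finset.card_insert_of_notMem h1, hcompl]
      · refine (h.matching.card_le (L' := insert (.pos a)
          ((c.erase (.pos a)).image Literal.compl)) fun d hd m hm hmL => ?_).trans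
          (Nat.add_le_add_left ((Finset.card_insert_le _ _).trans (by rw [hcompl])) _)
        obtain ⟨y, hy, hym⟩ := Finset.mem_image.1 hmL
        rcases Finset.mem_insert.1 hy with rfl | hy
        · exact ⟨m, hm, Finset.mem_image.2 ⟨_, Finset.mem_insert_self _ _, hym⟩⟩
        rcases Finset.mem_insert.1 hy with rfl | hy
        · have := h.matching.eq_of_atom d hd _ hk m hm (.pos b) (by simp) hym.symm
          exact ⟨.pos a, by simp [this], by simp⟩
        · exact ⟨m, hm, Finset.mem_image.2 ⟨_, Finset.mem_insert_of_mem hy, hym⟩⟩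
    have := Ratio.of_cover (K := K) (V := V) (T := T) (Finset.univ : Finset (Fin 3))
      ![{.pos a, .neg b}, {.neg a, .pos b}, L]
      ![base⁻¹ ^ 2 * gain ^ 1, 1 * base⁻¹ ^ 2 * gain ^ 1, base⁻¹ ^ 4 * gain ^ 3]
      (fun M hM => ?_) (fun i _ => by
        fin_cases i
        · exact banb
        · exact bnab1
        · exact bL)
    · refine this.mono ?_
      rw [Fin.sum_univ_three]
      change base⁻¹ ^ 2 * gain ^ 1 + 1 * base⁻¹ ^ 2 * gain ^ 1 + base⁻¹ ^ 4 * gain ^ 3 ≤ 1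
      norm_num [base, gain]
    · by_cases ha : a ∈ M
      · by_cases hb : b ∈ M
        · refine ⟨2, by simp, fun l hl => ?_⟩
          obtain ⟨c', hc', hf⟩ := hcrit M hM ha hb
          obtain rfl : c' = c := by rw [hc] at hc'; simpa using hc'
          replace hl : l ∈ L := hl
          rcases Finset.mem_insert.1 hl with rfl | hl
          · exact ha
          rcases Finset.mem_insert.1 hl with rfl | hl
          · exact hb
          · obtain ⟨y, hy, rfl⟩ := Finset.mem_image.1 hl
            rw [Literal.holds_compl]
            exact hf y (Finset.mem_of_mem_erase hy) (Finset.ne_of_mem_erase hy)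
        · exact ⟨0, by simp, by simp [Literal.Holds, ha, hb]⟩
      · exact ⟨1, by simp, by simpa [Literal.Holds, ha] using hcov M hM ha⟩
  · obtain ⟨c, hc, c', hc', hne⟩ := Finset.one_lt_card.1 hc2
    have ext : ∀ c ∈ P, c.erase (.pos a) ∈ assign T {.neg a, .pos b} ∧
        (c.erase (.pos a)).card = 2 ∧ c.erase (.pos a) ∉ untouched K {.neg a, .pos b} := by
      intro c hc
      obtain ⟨hcT, hac, hbc⟩ := Finset.mem_filter.1 hc
      have hna : Literal.neg a ∉ c := h.wf.compl_notMem c hcT _ hac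
      refine h.erase_extra hcT (three c hcT hac hbc) hac (by simp [Literal.compl])
        (by simp [hna, hbc]) fun x hx hne hx' => ?_
      have hnb := hcl c hcT hac
      cases x <;> simp_all [Literal.compl]
    have hne' : c.erase (.pos a) ≠ c'.erase (.pos a) := fun he => hne (by
      rw [← Finset.insert_erase (Finset.mem_filter.1 hc).2.1, he,
        Finset.insert_erase (Finset.mem_filter.1 hc').2.1])
    obtain ⟨e1, e2, e3⟩ := ext c hc
    obtain ⟨e1', e2', e3'⟩ := ext c' hc'
    have hR := ratio_of_two_extra hB hN (h.wf.assign _) (h.matching.untouched _) e1 e2 e3 e1' e2'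
      e3' hne'
    refine (Ratio.of_cover_two (fun M hM => ?_) ba (bnab _ (by norm_num) hR)).mono
      (by norm_num [base, gain])
    by_cases ha : a ∈ M
    · left; simpa [Literal.Holds] using ha
    · right; simpa [Literal.Holds, ha] using hcov M hM ha

end Main

/-! ### Theories in which every clause has three literals -/

section Uniform

variable {A : Type*} [DecidableEq A]

/-- The clauses in which the atom `a` occurs positively. -/
def posClauses (T : CNFTheory A) (a : A) : CNFTheory A := T.filter fun c => Literal.pos a ∈ c

/-- The clauses in which both `a` and `b` occur positively. -/
def commonClauses (T : CNFTheory A) (a b : A) : CNFTheory A :=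
  T.filter fun c => Literal.pos a ∈ c ∧ Literal.pos b ∈ c

/-- The assignment under which `c` is the clause on which the true atom `a` depends: `a` is true
and all other literals of `c` are false. -/
def critical (a : A) (c : Clause A) : Finset (Literal A) :=
  insert (.pos a) ((c.erase (.pos a)).image Literal.compl)

lemma mem_posClauses {T : CNFTheory A} {a : A} {c : Clause A} :
    c ∈ posClauses T a ↔ c ∈ T ∧ Literal.pos a ∈ c := Finset.mem_filter

lemma hasShort_neg {V : Finset A} {T : CNFTheory A} (hT : Wf V T) (a : A) :
    HasShort (posClauses T a).card (assign T {.neg a}) := by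
  refine hasShort_assign_of_three (l := .pos a) (Finset.filter_subset _ _) ?_ ?_
    (by simp [Literal.compl]) ?_
  · exact fun c hc => hT.card_le c (mem_posClauses.1 hc).1
  · exact fun c hc => (mem_posClauses.1 hc).2
  · intro c hc
    obtain ⟨hc, ha⟩ := mem_posClauses.1 hc
    rw [Finset.disjoint_singleton_right]
    exact hT.compl_notMem c hc _ ha

lemma ratioOn_literal {N e : ℕ} {r : ℝ} (hS : ShortBound A N e r) (hr : 0 ≤ r)
    {V : Finset A} {T : CNFTheory A} (hV : V.card ≤ N + 1) (hT : Wf V T) {l : Literal A}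
    (hl : l.atom ∈ V) (h : HasShort e (assign T {l})) : RatioOn V T ∅ {l} (r * base⁻¹) := by
  have hl' : ∀ x ∈ ({l} : Finset (Literal A)), x.atom ∈ V := by simpa using hl
  have := RatioOn.of_shortBound hS hr hT (card_sdiff_le_of_card_le_succ hV (by simp) hl') 1 hl'
    (by simp) h
  simpa using this

lemma ratioOn_literal_of_ratio {r : ℝ} (hr : 0 ≤ r) {V : Finset A} {T : CNFTheory A}
    {l : Literal A} (hl : l.atom ∈ V)
    (h : Ratio (V \ atomsOf {l}) (assign T {l}) ∅ r) : RatioOn V T ∅ {l} (r * base⁻¹) := by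
  have := RatioOn.of_assign (T := T) (K := ∅) (L := {l}) 1 0 hr (by simpa using hl)
    fun _ => ⟨by simp, by simp, by simpa [untouched] using h⟩
  simpa using this

lemma ratio_of_atom {V : Finset A} {T : CNFTheory A} {a : A} {r₁ r₂ : ℝ}
    (h₁ : RatioOn V T ∅ {.pos a} r₁) (h₂ : RatioOn V T ∅ {.neg a} r₂) : Ratio V T ∅ (r₁ + r₂) := by
  refine Ratio.of_cover_two (fun M _ => ?_) h₁ h₂
  by_cases ha : a ∈ M
  · left; simpa [Literal.Holds] using ha
  · right; simpa [Literal.Holds] using ha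

/-- Branching on `a` and, when it is true, on the clause on which it depends. -/
lemma ratio_of_critical {V : Finset A} {T : CNFTheory A} {a : A} {r r' : ℝ}
    (h₁ : RatioOn V T ∅ {.neg a} r)
    (h₂ : ∀ c ∈ posClauses T a, RatioOn V T ∅ (critical a c) r') :
    Ratio V T ∅ (r + (posClauses T a).card * r') := by
  have := Ratio.of_cover (K := ∅) (T := T) (V := V) (Finset.insertNone (posClauses T a))
    (fun o => o.elim {.neg a} (critical a)) (fun o => o.elim r fun _ => r') (fun M hM => ?_)
    (fun o ho => ?_)
  · rw [Finset.sum_insertNone] at this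
    simpa using this
  · by_cases ha : a ∈ M
    · obtain ⟨c, hc, hac, hf⟩ := (mem_irr.1 hM).2.exists_critical ha
      refine ⟨some c, by simp [mem_posClauses, hc, hac], fun l hl => ?_⟩
      rcases Finset.mem_insert.1 hl with rfl | hl
      · exact ha
      · obtain ⟨y, hy, rfl⟩ := Finset.mem_image.1 hl
        rw [Literal.holds_compl]
        exact hf y (Finset.mem_of_mem_erase hy) (Finset.ne_of_mem_erase hy)
    · exact ⟨none, by simp, by simpa [Literal.Holds] using ha⟩
  · cases o with
    | none => exact h₁
    | some c => exact h₂ c (by simpa using ho)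

lemma ratioOn_critical {N e : ℕ} {r : ℝ} (hS : ShortBound A N e r) (hr : 0 ≤ r)
    {V : Finset A} {T : CNFTheory A} (hV : V.card ≤ N + 1) (hT : Wf V T) {a : A} {c : Clause A}
    (hc : c ∈ posClauses T a) (h3 : c.card = 3) (h : HasShort e (assign T (critical a c))) :
    RatioOn V T ∅ (critical a c) (r * base⁻¹ ^ 3) := by
  obtain ⟨hcT, hac⟩ := mem_posClauses.1 hc
  have hLV : ∀ l ∈ critical a c, l.atom ∈ V := by
    intro l hl
    rcases Finset.mem_insert.1 hl with rfl | hl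
    · exact hT.atom_mem c hcT _ hac
    · obtain ⟨y, hy, rfl⟩ := Finset.mem_image.1 hl
      simpa using hT.atom_mem c hcT y (Finset.mem_of_mem_erase hy)
  refine RatioOn.of_shortBound hS hr hT
    (card_sdiff_le_of_card_le_succ hV (Finset.insert_nonempty _ _) hLV) 3 hLV (fun _ => ?_) h
  rw [Finset.card_insert_of_notMem, Finset.card_image_of_injective,
    Finset.card_erase_of_mem hac, h3]
  · exact fun x y hxy => by simpa using congrArg Literal.compl hxy
  · rw [mem_image_compl]
    exact fun hm => hT.compl_notMem c hcT _ hac (Finset.mem_of_mem_erase hm)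

lemma ratio_of_posClauses {N e : ℕ} {r : ℝ} (hB : Bounded A N) (hS : ShortBound A N e r)
    (hr : 0 ≤ r) {V : Finset A} {T : CNFTheory A} (hV : V.card ≤ N + 1) (hT : Wf V T)
    (h3 : ∀ c ∈ T, c.card = 3) {a : A} (ha : a ∈ V) (he : (posClauses T a).card = e) :
    Ratio V T ∅ (r * base⁻¹ + e * base⁻¹ ^ 3) := by
  have := ratio_of_critical
    (ratioOn_literal hS hr hV hT (l := .neg a) ha (he ▸ hasShort_neg hT a))
    (fun c hc => ratioOn_critical (shortBound_zero hB) zero_le_one hV hT hc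
      (h3 c (mem_posClauses.1 hc).1) (hasShort_zero _))
  rwa [he, one_mul] at this

lemma ratio_of_card_posClauses_le_one {N : ℕ} (hB : Bounded A N) {V : Finset A} {T : CNFTheory A}
    (hV : V.card ≤ N + 1) (hT : Wf V T) (h3 : ∀ c ∈ T, c.card = 3) {a : A} (ha : a ∈ V)
    (he : (posClauses T a).card ≤ 1) : Ratio V T ∅ 0.7591 := by
  obtain h | h : (posClauses T a).card = 0 ∨ (posClauses T a).card = 1 := by omega
  · exact (ratio_of_posClauses hB (shortBound_zero hB) (by norm_num) hV hT h3 ha h).mono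
      (by norm_num [base])
  · exact (ratio_of_posClauses hB (shortBound_one hB) (by norm_num) hV hT h3 ha h).mono
      (by norm_num [base])

lemma ratio_of_card_posClauses_le_two {N : ℕ} (hB : Bounded A N) {V : Finset A} {T : CNFTheory A}
    (hV : V.card ≤ N + 1) (hT : Wf V T) (h3 : ∀ c ∈ T, c.card = 3) {a : A} (ha : a ∈ V)
    (he : (posClauses T a).card ≤ 2) : Ratio V T ∅ 0.9243 := by
  obtain h | h : (posClauses T a).card ≤ 1 ∨ (posClauses T a).card = 2 := by omega
  · exact (ratio_of_card_posClauses_le_one hB hV hT h3 ha h).mono (by norm_num)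
  · exact (ratio_of_posClauses hB (shortBound_two hB) (by norm_num) hV hT h3 ha h).mono
      (by norm_num [base])

/-- An atom with both positive and negative occurrences. -/
lemma ratio_of_mixed {N : ℕ} (hB : Bounded A N) {V : Finset A} {T : CNFTheory A}
    (hV : V.card ≤ N + 1) (hT : Wf V T) {a : A} (hp : 3 ≤ (posClauses T a).card) {c : Clause A}
    (hc : c ∈ T) (hac : Literal.neg a ∈ c) : Ratio V T ∅ 1 := by
  have ha : a ∈ V := hT.atom_mem c hc _ hac
  have h₁ : HasShort 1 (assign T {.pos a}) := by
    refine hasShort_assign_of_three (l := .neg a) (C := {c}) (by simpa using hc)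
      (by simpa using hT.card_le c hc) (by simpa using hac) (by simp [Literal.compl]) ?_
    simpa [Literal.compl] using hT.compl_notMem c hc _ hac
  exact (ratio_of_atom (ratioOn_literal (shortBound_one hB) (by norm_num) hV hT ha h₁)
    (ratioOn_literal (shortBound_three hB) (by norm_num) hV hT ha
      ((hasShort_neg hT a).mono hp))).mono (by norm_num [base])

/-- `T` consists of three-literal clauses without negation, that is, it is a 3-uniform
hypergraph. -/
structure PositiveUniform (T : CNFTheory A) : Prop where
  card_eq : ∀ c ∈ T, c.card = 3
  neg_notMem : ∀ c ∈ T, ∀ a, Literal.neg a ∉ c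

lemma PositiveUniform.assign_pos {T : CNFTheory A} (h : PositiveUniform T) (a : A) :
    assign T {.pos a} = T.filter fun c => Literal.pos a ∉ c := by
  have hid : ∀ c ∈ T, c \ ({.pos a} : Finset (Literal A)).image Literal.compl = c := fun c hc => by
    simpa [Literal.compl] using h.neg_notMem c hc a
  ext c
  simp only [mem_assign, Finset.disjoint_singleton_right, Finset.mem_filter]
  constructor
  · rintro ⟨d, hd, hda, rfl⟩
    rw [hid d hd]
    exact ⟨hd, hda⟩
  · rintro ⟨hc, ha⟩
    exact ⟨c, hc, ha, hid c hc⟩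

lemma PositiveUniform.assign {T : CNFTheory A} (h : PositiveUniform T) (a : A) :
    PositiveUniform (ASP.assign T {.pos a}) := by
  rw [h.assign_pos]
  exact ⟨fun c hc => h.card_eq c (Finset.mem_filter.1 hc).1,
    fun c hc => h.neg_notMem c (Finset.mem_filter.1 hc).1⟩

/-- Making `b` true removes the clauses that contain `a` and `b`. -/
lemma PositiveUniform.card_posClauses_assign {T : CNFTheory A} (h : PositiveUniform T) (a b : A) :
    (posClauses (ASP.assign T {.pos b}) a).card + (commonClauses T a b).card =
      (posClauses T a).card := by
  rw [← Finset.card_filter_add_card_filter_not (s := posClauses T a) fun c => Literal.pos b ∈ c,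
    add_comm, h.assign_pos]
  congr 2
  · ext c; simp [commonClauses, posClauses, and_assoc]
  · ext c; simp [posClauses]; tauto

lemma PositiveUniform.exists_other {T : CNFTheory A} (h : PositiveUniform T) {a : A} {c : Clause A}
    (hc : c ∈ posClauses T a) : ∃ b, b ≠ a ∧ Literal.pos b ∈ c := by
  obtain ⟨hcT, hac⟩ := mem_posClauses.1 hc
  have : (c.erase (.pos a)).Nonempty := by
    rw [← Finset.card_pos, Finset.card_erase_of_mem hac, h.card_eq c hcT]
    norm_num
  obtain ⟨l, hl⟩ := this
  cases l with
  | pos b => exact ⟨b, by simpa using Finset.ne_of_mem_erase hl, Finset.mem_of_mem_erase hl⟩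
  | neg b => exact absurd (Finset.mem_of_mem_erase hl) (h.neg_notMem c hcT b)

lemma PositiveUniform.ratioOn_pos {N : ℕ} {r : ℝ} (hr : 0 ≤ r) {V : Finset A} {T : CNFTheory A}
    (hV : V.card ≤ N + 1) (hT : Wf V T) (h : PositiveUniform T) {a : A} (ha : a ∈ V)
    (hR : ∀ (V' : Finset A) (T' : CNFTheory A), V'.card ≤ N + 1 → Wf V' T' → PositiveUniform T' →
      V' = V.erase a → T' = ASP.assign T {.pos a} → Ratio V' T' ∅ r) :
    RatioOn V T ∅ {.pos a} (r * base⁻¹) := by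
  refine ratioOn_literal_of_ratio hr ha (hR _ _ ?_ (hT.assign _) (h.assign a) ?_ rfl)
  · exact (Finset.card_le_card Finset.sdiff_subset).trans hV
  · simp [Literal.atom, Finset.sdiff_singleton_eq_erase]

/-- A hypergraph with a vertex `a` of degree at most three. If it has degree three and meets every
other vertex in one edge only, then an atom of the clause on which `a` depends lies in two further
clauses, which become two-literal clauses. -/
lemma PositiveUniform.ratio_of_degree_le_three {N : ℕ} (hB : Bounded A N) {V : Finset A}
    {T : CNFTheory A} (hV : V.card ≤ N + 1) (hT : Wf V T) (h : PositiveUniform T) {a : A}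
    (ha : a ∈ V) (hd : (posClauses T a).card ≤ 3) : Ratio V T ∅ 0.9868 := by
  by_cases h2 : ∃ b ∈ V, (posClauses T b).card ≤ 2
  · obtain ⟨b, hb, hb2⟩ := h2
    exact (ratio_of_card_posClauses_le_two hB hV hT h.card_eq hb hb2).mono (by norm_num)
  push Not at h2
  have hd3 : (posClauses T a).card = 3 := le_antisymm hd (h2 a ha)
  by_cases hs : ∃ b, b ≠ a ∧ 2 ≤ (commonClauses T a b).card
  · obtain ⟨b, hba, hs⟩ := hs
    have hbV : b ∈ V := by
      obtain ⟨c, hc⟩ := Finset.card_pos.1 (by omega : 0 < (commonClauses T a b).card)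
      obtain ⟨hc, -, hbc⟩ := Finset.mem_filter.1 hc
      exact hT.atom_mem c hc _ hbc
    have hcard := h.card_posClauses_assign a b
    have b₁ := h.ratioOn_pos (r := 0.7591) (by norm_num) hV hT hbV fun V' T' hV' hT' h' hv ht =>
      ratio_of_card_posClauses_le_one hB hV' hT' h'.card_eq (a := a)
        (by rw [hv]; exact Finset.mem_erase.2 ⟨hba.symm, ha⟩) (by rw [ht]; omega)
    have b₂ := ratioOn_literal (shortBound_three hB) (by norm_num) hV hT (l := .neg b) hbV
      ((hasShort_neg hT b).mono (h2 b hbV))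
    exact (ratio_of_atom b₁ b₂).mono (by norm_num [base])
  · push Not at hs
    have b₁ := ratioOn_literal (shortBound_three hB) (by norm_num) hV hT (l := .neg a) ha
      ((hasShort_neg hT a).mono hd3.ge)
    have b₂ : ∀ c ∈ posClauses T a, RatioOn V T ∅ (critical a c) (0.8265 * base⁻¹ ^ 3) := by
      intro c hc
      obtain ⟨b, hba, hbc⟩ := h.exists_other hc
      have hcT := (mem_posClauses.1 hc).1
      refine ratioOn_critical (shortBound_two hB) (by norm_num) hV hT hc (h.card_eq c hcT) ?_
      refine (hasShort_assign_of_three (l := .pos b) (C := posClauses (ASP.assign T {.pos a}) b)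
        ?_ ?_ ?_ ?_ ?_).mono ?_
      · intro c hc
        have hc := (mem_posClauses.1 hc).1
        rw [h.assign_pos] at hc
        exact (Finset.mem_filter.1 hc).1
      · exact fun c hc => ((h.assign a).card_eq c (mem_posClauses.1 hc).1).le
      · exact fun c hc => (mem_posClauses.1 hc).2
      · refine Finset.mem_insert_of_mem (Finset.mem_image_of_mem _ ?_)
        exact Finset.mem_erase.2 ⟨by simpa using hba, hbc⟩
      · intro c' hc'
        have hc' := (mem_posClauses.1 hc').1
        rw [h.assign_pos] at hc'
        obtain ⟨hcT', hac'⟩ := Finset.mem_filter.1 hc'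
        refine Finset.disjoint_right.2 fun l hl hlc => ?_
        rcases Finset.mem_insert.1 hl with rfl | hl
        · exact hac' hlc
        · obtain ⟨y, hy, rfl⟩ := Finset.mem_image.1 hl
          cases y with
          | pos z => exact h.neg_notMem c' hcT' z hlc
          | neg z => exact h.neg_notMem c hcT z (Finset.mem_of_mem_erase hy)
      · have h4 := h.card_posClauses_assign b a
        have h5 := h2 b (hT.atom_mem c hcT _ hbc)
        have h6 := hs b hba
        have h7 : commonClauses T b a = commonClauses T a b := by
          ext c; simp [commonClauses]; tauto
        rw [h7] at h4
        omega
    refine (ratio_of_critical b₁ b₂).mono ?_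
    rw [hd3]
    norm_num [base]

/-- The remaining hypergraphs are regular of degree four, or have a vertex of degree five. -/
lemma PositiveUniform.ratio {N : ℕ} (hB : Bounded A N) {V : Finset A} {T : CNFTheory A}
    (hV : V.card ≤ N + 1) (hT : Wf V T) (h : PositiveUniform T) : Ratio V T ∅ 1 := by
  rcases V.eq_empty_or_nonempty with rfl | ⟨a, ha⟩
  · exact hB _ _ _ (by simp) hT (IsMatching.empty T)
  by_cases h3 : ∃ b ∈ V, (posClauses T b).card ≤ 3
  · obtain ⟨b, hb, hd⟩ := h3
    exact (h.ratio_of_degree_le_three hB hV hT hb hd).mono (by norm_num)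
  push Not at h3
  by_cases h5 : ∃ b ∈ V, 5 ≤ (posClauses T b).card
  · obtain ⟨b, hb, hd⟩ := h5
    have b₁ := ratioOn_literal (shortBound_zero hB) zero_le_one hV hT (l := .pos b) hb
      (hasShort_zero _)
    have b₂ := ratioOn_literal (shortBound_five hB) (by norm_num) hV hT (l := .neg b) hb
      ((hasShort_neg hT b).mono hd)
    exact (ratio_of_atom b₁ b₂).mono (by norm_num [base])
  push Not at h5
  have h4 : ∀ b ∈ V, (posClauses T b).card = 4 := fun b hb => by
    have := h3 b hb
    have := h5 b hb
    omega
  by_cases hs : ∃ b, b ≠ a ∧ 2 ≤ (commonClauses T b a).card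
  · obtain ⟨b, hba, hs⟩ := hs
    have hbV : b ∈ V := by
      obtain ⟨c, hc⟩ := Finset.card_pos.1 (by omega : 0 < (commonClauses T b a).card)
      obtain ⟨hc, hbc, -⟩ := Finset.mem_filter.1 hc
      exact hT.atom_mem c hc _ hbc
    have hcard := h.card_posClauses_assign b a
    have b₁ := h.ratioOn_pos (r := 0.9243) (by norm_num) hV hT ha fun V' T' hV' hT' h' hv ht =>
      ratio_of_card_posClauses_le_two hB hV' hT' h'.card_eq (a := b)
        (by rw [hv]; exact Finset.mem_erase.2 ⟨hba, hbV⟩)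
        (by rw [ht]; have := h4 b hbV; omega)
    have b₂ := ratioOn_literal (shortBound_four hB) (by norm_num) hV hT (l := .neg a) ha
      ((hasShort_neg hT a).mono (h4 a ha).ge)
    exact (ratio_of_atom b₁ b₂).mono (by norm_num [base])
  · push Not at hs
    obtain ⟨c, hc⟩ := Finset.card_pos.1 (by rw [h4 a ha]; norm_num : 0 < (posClauses T a).card)
    obtain ⟨b, hba, hbc⟩ := h.exists_other hc
    have hbV : b ∈ V := hT.atom_mem c (mem_posClauses.1 hc).1 _ hbc
    have hcard := h.card_posClauses_assign b a
    have hpos : 0 < (commonClauses T b a).card := Finset.card_pos.2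
      ⟨c, Finset.mem_filter.2 ⟨(mem_posClauses.1 hc).1, hbc, (mem_posClauses.1 hc).2⟩⟩
    have b₁ := h.ratioOn_pos (r := 0.9868) (by norm_num) hV hT ha fun V' T' hV' hT' h' hv ht =>
      h'.ratio_of_degree_le_three hB hV' hT' (a := b)
        (by rw [hv]; exact Finset.mem_erase.2 ⟨hba, hbV⟩)
        (by rw [ht]; have := h4 b hbV; omega)
    -- when `a` is false, its four clauses become a matching
    set K := (posClauses T a).image fun c => c.erase (.pos a) with hK
    have hKcard : K.card = 4 := by
      rw [hK, Finset.card_image_of_injOn, h4 a ha]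
      intro c hc c' hc' he
      have he : c.erase (.pos a) = c'.erase (.pos a) := he
      rw [← Finset.insert_erase (mem_posClauses.1 hc).2, he,
        Finset.insert_erase (mem_posClauses.1 hc').2]
    have hKm : IsMatching (ASP.assign T {.neg a}) K := by
      refine ⟨?_, ?_, ?_⟩
      · refine Finset.image_subset_iff.2 fun c hc => ?_
        obtain ⟨hcT, hac⟩ := mem_posClauses.1 hc
        refine mem_assign.2 ⟨c, hcT, ?_, ?_⟩
        · rw [Finset.disjoint_singleton_right]
          exact h.neg_notMem c hcT a
        · rw [Finset.image_singleton, Finset.sdiff_singleton_eq_erase]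
          rfl
      · intro d hd
        obtain ⟨c, hc, rfl⟩ := Finset.mem_image.1 hd
        obtain ⟨hcT, hac⟩ := mem_posClauses.1 hc
        rw [Finset.card_erase_of_mem hac, h.card_eq c hcT]
      · intro d hd d' hd' l hl l' hl' hll
        obtain ⟨c, hc, rfl⟩ := Finset.mem_image.1 hd
        obtain ⟨c', hc', rfl⟩ := Finset.mem_image.1 hd'
        obtain ⟨hcT, hac⟩ := mem_posClauses.1 hc
        obtain ⟨hcT', hac'⟩ := mem_posClauses.1 hc'
        obtain ⟨hla, hlc⟩ := Finset.mem_erase.1 hl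
        obtain ⟨-, hlc'⟩ := Finset.mem_erase.1 hl'
        cases l with
        | neg z => exact absurd hlc (h.neg_notMem c hcT z)
        | pos z =>
          cases l' with
          | neg z' => exact absurd hlc' (h.neg_notMem c' hcT' z')
          | pos z' =>
            obtain rfl : z = z' := hll
            have hz := hs z (by simpa using hla)
            have : c = c' := Finset.card_le_one.1 (Nat.lt_succ_iff.1 hz) c
              (Finset.mem_filter.2 ⟨hcT, hlc, hac⟩) c' (Finset.mem_filter.2 ⟨hcT', hlc', hac'⟩)
            rw [this]
    have hN : (V \ atomsOf {Literal.neg a}).card ≤ N :=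
      card_sdiff_le_of_card_le_succ hV (by simp) (by simpa [Literal.atom] using ha)
    have hR : Ratio (V \ atomsOf {Literal.neg a}) (ASP.assign T {.neg a}) ∅ (gain⁻¹ ^ 4) := by
      have := hB _ _ _ hN (hT.assign _) hKm
      unfold Ratio at this ⊢
      rw [hKcard] at this
      rw [inv_pow, inv_mul_eq_div, le_div_iff₀ (gain_pow_pos 4)]
      simpa using this
    have b₂ := ratioOn_literal_of_ratio (by norm_num [gain]) (l := .neg a) ha hR
    exact (ratio_of_atom b₁ b₂).mono (by norm_num [base, gain])

end Uniform

/-! ### The bound for 3-CNF theories -/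

section CNF

variable {A : Type*} [DecidableEq A]

/-- Removing the clauses that properly contain another clause. -/
def minimalClauses (T : CNFTheory A) : CNFTheory A := T.filter fun c => ∀ d ∈ T, d ⊆ c → d = c

lemma models_minimalClauses (T : CNFTheory A) (M : Finset A) :
    Models T M ↔ Models (minimalClauses T) M := by
  refine ⟨fun h c hc => h c (Finset.mem_filter.1 hc).1, fun h c hc => ?_⟩
  obtain ⟨d, hd, hmin⟩ := Finset.exists_min_image (T.filter fun d => d ⊆ c) Finset.card
    ⟨c, by simp [hc]⟩
  obtain ⟨hdT, hdc⟩ := Finset.mem_filter.1 hd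
  obtain ⟨l, hl, hM⟩ := h d (Finset.mem_filter.2 ⟨hdT, fun e he hed =>
    Finset.eq_of_subset_of_card_le hed (hmin e (Finset.mem_filter.2 ⟨he, hed.trans hdc⟩))⟩)
  exact ⟨l, hdc hl, hM⟩

lemma Reduced.ratio {N : ℕ} (hB : Bounded A N) {V : Finset A} {T K : CNFTheory A}
    (hV : V.card ≤ N + 1) (h : Reduced V T K) : Ratio V T K 1 := by
  rcases K.eq_empty_or_nonempty with rfl | ⟨k, hk⟩
  · have h3 : ∀ c ∈ T, c.card = 3 := fun c hc => by
      have h1 := h.two_le c hc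
      have h2 := h.wf.card_le c hc
      have h3 : c.card ≠ 2 := fun h2 => absurd (h.mem_of_card c hc h2) (Finset.notMem_empty c)
      omega
    by_cases h2 : ∃ a ∈ V, (posClauses T a).card ≤ 2
    · obtain ⟨a, ha, h2⟩ := h2
      exact (ratio_of_card_posClauses_le_two hB hV h.wf h3 ha h2).mono (by norm_num)
    · push Not at h2
      by_cases hn : ∃ c ∈ T, ∃ a, Literal.neg a ∈ c
      · obtain ⟨c, hc, a, hac⟩ := hn
        exact ratio_of_mixed hB hV h.wf (h2 a (h.wf.atom_mem c hc _ hac)) hc hac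
      · push Not at hn
        exact PositiveUniform.ratio hB hV h.wf ⟨h3, hn⟩
  · obtain ⟨l, m, hlm, rfl⟩ := Finset.card_eq_two.1 (h.matching.card_eq k hk)
    cases l with
    | neg a => exact h.ratio_of_neg hB hV hk
    | pos a =>
      cases m with
      | neg b => exact h.ratio_of_neg hB hV (a := b) (d := .pos a) (by rwa [Finset.pair_comm])
      | pos b => exact h.ratio_of_pos hB hV hk (by simpa using hlm)

/-- The induction on the number of atoms. It is enough to treat a largest matching and a theory
without superfluous clauses. -/
theorem bounded (N : ℕ) : Bounded A N := by
  induction N with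
  | zero =>
    intro V T K hV hT hK
    obtain rfl : V = ∅ := Finset.card_eq_zero.1 (Nat.le_zero.1 hV)
    obtain rfl : K = ∅ := Finset.eq_empty_of_forall_notMem fun k hk => by
      obtain ⟨l, hl⟩ := Finset.card_pos.1 (by rw [hK.card_eq k hk]; norm_num : 0 < k.card)
      exact absurd (hT.atom_mem k (hK.subset hk) l hl) (Finset.notMem_empty _)
    have : (irr ∅ T).card ≤ 1 := Finset.card_le_one.2 fun M hM M' hM' => by
      rw [Finset.subset_empty.1 (mem_irr.1 hM).1, Finset.subset_empty.1 (mem_irr.1 hM').1]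
    simpa [Ratio] using this
  | succ N hB =>
    intro V T K hV hT hK
    by_cases h1 : ∃ c ∈ T, c.card ≤ 1
    · obtain ⟨c, hc, h1⟩ := h1
      exact (Ratio.of_card_le_one hB hV hT hK hc h1).mono (by norm_num [base, gain])
    push Not at h1
    classical
    obtain ⟨K', hK', hmax⟩ := Finset.exists_max_image
      (T.powerset.filter fun K' => IsMatching T K') Finset.card
      ⟨K, Finset.mem_filter.2 ⟨Finset.mem_powerset.2 hK.subset, hK⟩⟩
    have hm : IsMatching T K' := (Finset.mem_filter.1 hK').2
    have hKK' : K.card ≤ K'.card :=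
      hmax K (Finset.mem_filter.2 ⟨Finset.mem_powerset.2 hK.subset, hK⟩)
    suffices h : Ratio V T K' 1 from
      (mul_le_mul_of_nonneg_left (pow_le_pow_right₀ one_le_gain hKK') (Nat.cast_nonneg _)).trans h
    by_cases hex : ∃ c ∈ T, c.card = 2 ∧ c ∉ K'
    · obtain ⟨c, hc, h2, hcK⟩ := hex
      by_cases ht : ∀ k ∈ K', ∀ l ∈ c, ∀ m ∈ k, l.atom ≠ m.atom
      · have hi := hm.insert hc h2 ht
        have := hmax _ (Finset.mem_filter.2 ⟨Finset.mem_powerset.2 hi.subset, hi⟩)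
        rw [Finset.card_insert_of_notMem hcK] at this
        omega
      · push Not at ht
        obtain ⟨k, hk, l, hl, m, hmk, hlm⟩ := ht
        exact (ratio_of_touching hB hV hT hm hc h2 hcK hk hl hmk hlm).mono (by norm_num)
    · push Not at hex
      have hsub : minimalClauses T ⊆ T := Finset.filter_subset _ _
      have hred : Reduced V (minimalClauses T) K' := by
        refine ⟨⟨fun c hc => hT.card_le c (hsub hc), fun c hc => hT.compl_notMem c (hsub hc),
          fun c hc => hT.atom_mem c (hsub hc)⟩, ⟨fun k hk => ?_, hm.card_eq, hm.eq_of_atom⟩,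
          fun c hc => h1 c (hsub hc), fun c hc => hex c (hsub hc), fun c hc c' hc' hcc =>
            (Finset.mem_filter.1 hc').2 c (hsub hc) hcc⟩
        refine Finset.mem_filter.2 ⟨hm.subset hk, fun d hd hdk => ?_⟩
        exact Finset.eq_of_subset_of_card_le hdk (by rw [hm.card_eq k hk]; exact h1 d hd)
      have := hred.ratio hB hV
      unfold Ratio at this ⊢
      rwa [irr_congr (models_minimalClauses T)]

/-- A 3-CNF theory over the atoms `V` has at most `base ^ |V|` irredundant models. -/
theorem card_irr_le {V : Finset A} {T : CNFTheory A} (hT : Wf V T) :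
    ((irr V T).card : ℝ) ≤ base ^ V.card := by
  simpa [Ratio] using bounded V.card V T ∅ le_rfl hT (IsMatching.empty T)

lemma CNFTheory.isModel_iff {T : CNFTheory A} {M : Finset A} :
    T.IsModel M ↔ M ⊆ T.atoms ∧ Models T M := by
  refine and_congr_right fun hM => forall₂_congr fun c hc => ?_
  constructor
  · rintro (⟨a, ha, hac⟩ | ⟨a, ha, hac⟩)
    · exact ⟨_, hac, ha⟩
    · exact ⟨_, hac, (Finset.mem_sdiff.1 ha).2⟩
  · rintro ⟨l, hl, hM⟩
    cases l with
    | pos a => exact Or.inl ⟨a, hM, hl⟩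
    | neg a =>
      refine Or.inr ⟨a, Finset.mem_sdiff.2 ⟨?_, hM⟩, hl⟩
      exact Finset.mem_biUnion.2 ⟨c, hc, Finset.mem_image.2 ⟨_, hl, rfl⟩⟩

/-- The clauses that are not tautologies. -/
def nontautological (T : CNFTheory A) : CNFTheory A := T.filter fun c => ∀ l ∈ c, l.compl ∉ c

lemma models_nontautological (T : CNFTheory A) (M : Finset A) :
    Models T M ↔ Models (nontautological T) M := by
  refine ⟨fun h c hc => h c (Finset.mem_filter.1 hc).1, fun h c hc => ?_⟩
  by_cases ht : ∀ l ∈ c, l.compl ∉ c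
  · exact h c (Finset.mem_filter.2 ⟨hc, ht⟩)
  · push Not at ht
    obtain ⟨l, hl, hl'⟩ := ht
    by_cases hM : l.Holds M
    · exact ⟨l, hl, hM⟩
    · exact ⟨_, hl', (Literal.holds_compl M l).2 hM⟩

lemma CNFTheory.IsMinimalModel.mem_irr {T : CNFTheory A} {M : Finset A} (h : T.IsMinimalModel M) :
    M ∈ irr T.atoms T := by
  obtain ⟨hM, hmod⟩ := CNFTheory.isModel_iff.1 h.1
  refine ASP.mem_irr.2 ⟨hM, hmod, fun a ha he => ?_⟩
  exact h.2 _ (Finset.erase_ssubset ha)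
    (CNFTheory.isModel_iff.2 ⟨(Finset.erase_subset _ _).trans hM, he⟩)

theorem CNFTheory.card_irr_le {T : CNFTheory A} (hT : T.IsCNF 3) :
    ((irr T.atoms T).card : ℝ) ≤ base ^ T.atoms.card := by
  rw [irr_congr (models_nontautological T)]
  refine ASP.card_irr_le ⟨fun c hc => hT c (Finset.mem_filter.1 hc).1,
    fun c hc => (Finset.mem_filter.1 hc).2, fun c hc l hl => ?_⟩
  exact Finset.mem_biUnion.2 ⟨c, (Finset.mem_filter.1 hc).1, Finset.mem_image_of_mem _ hl⟩

lemma ncard_le_of_subset_irr {V : Finset A} {T : CNFTheory A} {S : Set (Finset A)} {x : ℝ}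
    (hS : ∀ M ∈ S, M ∈ irr V T) (hx : ((irr V T).card : ℝ) ≤ x) : S.Finite ∧ (S.ncard : ℝ) ≤ x := by
  have hsub : S ⊆ (irr V T : Set (Finset A)) := hS
  refine ⟨(irr V T).finite_toSet.subset hsub, le_trans ?_ hx⟩
  have := Set.ncard_le_ncard hsub (irr V T).finite_toSet
  rw [Set.ncard_coe_finset] at this
  exact_mod_cast this

end CNF

/-! ### Logic programs -/

section Programs

variable {A : Type*} [DecidableEq A]

/-- The clause `c₁ ∨ … ∨ cₚ ∨ ¬a₁ ∨ … ∨ ¬aᵣ ∨ b₁ ∨ … ∨ bₛ` of a rule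
`c₁ ∨ … ∨ cₚ ← a₁, …, aᵣ, not b₁, …, not bₛ`. -/
def DisjunctiveRule.toClause (r : DisjunctiveRule A) : Clause A :=
  r.head.image .pos ∪ r.posBody.image .neg ∪ r.negBody.image .pos

/-- The 3-CNF theory whose minimal models include the answer sets of a program. -/
def DisjunctiveProgram.toCNF (P : DisjunctiveProgram A) : CNFTheory A :=
  P.image DisjunctiveRule.toClause

lemma DisjunctiveProgram.atoms_toCNF (P : DisjunctiveProgram A) : P.toCNF.atoms = P.atoms := by
  ext a
  simp only [CNFTheory.atoms, toCNF, atoms, DisjunctiveRule.toClause, Finset.mem_biUnion,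
    Finset.mem_image, exists_exists_and_eq_and, Finset.mem_union]
  refine exists_congr fun r => and_congr_right fun _ => ?_
  constructor
  · rintro ⟨l, (⟨b, hb, rfl⟩ | ⟨b, hb, rfl⟩) | ⟨b, hb, rfl⟩, rfl⟩ <;> simp [Literal.atom, hb]
  · rintro ((h | h) | h)
    · exact ⟨.pos a, Or.inl (Or.inl ⟨a, h, rfl⟩), rfl⟩
    · exact ⟨.neg a, Or.inl (Or.inr ⟨a, h, rfl⟩), rfl⟩
    · exact ⟨.pos a, Or.inr ⟨a, h, rfl⟩, rfl⟩

lemma DisjunctiveProgram.IsTProgram.isCNF {P : DisjunctiveProgram A} {t : ℕ}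
    (h : P.IsTProgram t) : P.toCNF.IsCNF t := by
  intro c hc
  obtain ⟨r, hr, rfl⟩ := Finset.mem_image.1 hc
  refine le_trans ?_ (h r hr)
  refine (Finset.card_union_le _ _).trans (Nat.add_le_add ?_ Finset.card_image_le)
  exact (Finset.card_union_le _ _).trans (Nat.add_le_add Finset.card_image_le Finset.card_image_le)

lemma DisjunctiveProgram.models_toCNF {P : DisjunctiveProgram A} {M : Finset A} :
    Models P.toCNF M ↔ P.IsModel M := by
  simp only [Models, toCNF, Finset.forall_mem_image, DisjunctiveRule.toClause, IsModel]
  refine forall₂_congr fun r _ => ?_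
  constructor
  · rintro ⟨l, hl, hM⟩ hp hn
    simp only [Finset.mem_union, Finset.mem_image] at hl
    rcases hl with (⟨b, hb, rfl⟩ | ⟨b, hb, rfl⟩) | ⟨b, hb, rfl⟩
    · exact ⟨b, hb, hM⟩
    · exact absurd (hp hb) hM
    · exact absurd hM (Finset.disjoint_left.1 hn hb)
  · intro h
    simp only [Finset.mem_union, Finset.mem_image]
    by_cases hp : r.posBody ⊆ M
    · by_cases hn : Disjoint r.negBody M
      · obtain ⟨c, hc, hM⟩ := h hp hn
        exact ⟨.pos c, Or.inl (Or.inl ⟨c, hc, rfl⟩), hM⟩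
      · obtain ⟨b, hb, hM⟩ := Finset.not_disjoint_iff.1 hn
        exact ⟨.pos b, Or.inr ⟨b, hb, rfl⟩, hM⟩
    · obtain ⟨b, hb, hM⟩ := Finset.not_subset.1 hp
      exact ⟨.neg b, Or.inl (Or.inr ⟨b, hb, rfl⟩), hM⟩

lemma DisjunctiveProgram.isModel_reduct {P : DisjunctiveProgram A} {M N : Finset A} :
    (P.reduct M).IsModel N ↔
      ∀ r ∈ P, Disjoint r.negBody M → r.posBody ⊆ N → ∃ c ∈ r.head, c ∈ N := by
  simp only [IsModel, reduct, Finset.forall_mem_image, Finset.mem_filter]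
  exact ⟨fun h r hr hn hp => h ⟨hr, hn⟩ hp (by simp), fun h r hr hp _ => h r hr.1 hr.2 hp⟩

/-- A subset of `M` that satisfies `P` also satisfies the reduct, because rules that the reduct
keeps have no `not b` with `b ∈ M`. Hence an answer set is a minimal model of the theory of `P`. -/
lemma DisjunctiveProgram.IsAnswerSet.mem_irr {P : DisjunctiveProgram A} {M : Finset A}
    (h : P.IsAnswerSet M) : M ∈ irr P.atoms P.toCNF := by
  obtain ⟨hM, hmin⟩ := h
  rw [isModel_reduct] at hM
  refine ASP.mem_irr.2 ⟨fun a ha => ?_, models_toCNF.2 fun r hr hp hn => hM r hr hn hp,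
    fun a ha he => ?_⟩
  · -- an atom that does not occur in `P` could be removed
    by_contra haP
    refine hmin _ (Finset.erase_ssubset ha) (isModel_reduct.2 fun r hr hn hp => ?_)
    obtain ⟨c, hc, hcM⟩ := hM r hr hn (hp.trans (Finset.erase_subset _ _))
    refine ⟨c, hc, Finset.mem_erase.2 ⟨?_, hcM⟩⟩
    rintro rfl
    exact haP (Finset.mem_biUnion.2 ⟨r, hr, by simp [hc]⟩)
  · refine hmin _ (Finset.erase_ssubset ha) (isModel_reduct.2 fun r hr hn hp => ?_)
    exact models_toCNF.1 he r hr hp (hn.mono_right (Finset.erase_subset _ _))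

/-- A normal program as a disjunctive program. -/
def NormalProgram.toDisjunctive (P : NormalProgram A) : DisjunctiveProgram A :=
  P.image fun r => ⟨{r.head}, r.posBody, r.negBody⟩

lemma NormalProgram.atoms_toDisjunctive (P : NormalProgram A) :
    P.toDisjunctive.atoms = P.atoms := by
  ext a
  simp [DisjunctiveProgram.atoms, toDisjunctive, atoms]

lemma NormalProgram.isModel_reduct_toDisjunctive {P : NormalProgram A} {M N : Finset A} :
    (P.toDisjunctive.reduct M).IsModel N ↔ (P.reduct M).IsModel N := by
  rw [DisjunctiveProgram.isModel_reduct]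
  simp only [toDisjunctive, Finset.forall_mem_image, IsModel, reduct, Finset.mem_filter]
  constructor
  · rintro h r ⟨hr, hM⟩ hp -
    simpa using h hr hM hp
  · intro h r hr hM hp
    simpa using h ⟨hr, hM⟩ hp (by simp)

lemma NormalProgram.IsStableModel.isAnswerSet {P : NormalProgram A} {M : Finset A}
    (h : P.IsStableModel M) : P.toDisjunctive.IsAnswerSet M := by
  refine ⟨isModel_reduct_toDisjunctive.2 h.1, fun N hN hmod => ?_⟩
  exact hN.not_subset (h.2 (isModel_reduct_toDisjunctive.1 hmod))

lemma NormalProgram.IsTProgram.toDisjunctive {P : NormalProgram A} {t : ℕ}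
    (h : P.IsTProgram t) : P.toDisjunctive.IsTProgram t := by
  intro r hr
  obtain ⟨r', hr', rfl⟩ := Finset.mem_image.1 hr
  simpa using h r' hr'

end Programs

/-! ### The constants -/

/-- With `v = τ ^ α`, the second equation says `τ = 1 + v ^ (-4)`, and the first one becomes a
polynomial equation in `v`. -/
lemma exists_solution : ∃ v τ : ℝ, v ∈ Set.Icc (1.10523 : ℝ) 1.10524 ∧ τ = 1 + v⁻¹ ^ 4 ∧
    v / τ + v ^ 3 / τ ^ 4 + 2 * (v ^ 4 / τ ^ 6) + v ^ 5 / τ ^ 8 = 1 := by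
  let g : ℝ → ℝ := fun v => v / (1 + v⁻¹ ^ 4) + v ^ 3 / (1 + v⁻¹ ^ 4) ^ 4 +
    2 * (v ^ 4 / (1 + v⁻¹ ^ 4) ^ 6) + v ^ 5 / (1 + v⁻¹ ^ 4) ^ 8
  have hpos : ∀ v : ℝ, 1 + v⁻¹ ^ 4 ≠ 0 := fun v => by positivity
  have hg : ContinuousOn g (Set.Icc 1.10523 1.10524) := by
    have hinv : ContinuousOn (fun v : ℝ => v⁻¹) (Set.Icc 1.10523 1.10524) :=
      continuousOn_inv₀.mono fun v hv => by
        have : (0 : ℝ) < v := lt_of_lt_of_le (by norm_num) hv.1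
        exact this.ne'
    have hden : ContinuousOn (fun v : ℝ => 1 + v⁻¹ ^ 4) (Set.Icc 1.10523 1.10524) :=
      continuousOn_const.add (hinv.pow 4)
    exact (((continuousOn_id.div hden fun v _ => hpos v).add
      ((continuousOn_id.pow 3).div (hden.pow 4) fun v _ => pow_ne_zero _ (hpos v))).add
      (continuousOn_const.mul
        ((continuousOn_id.pow 4).div (hden.pow 6) fun v _ => pow_ne_zero _ (hpos v)))).add
      ((continuousOn_id.pow 5).div (hden.pow 8) fun v _ => pow_ne_zero _ (hpos v))
  obtain ⟨v, hv, h⟩ := intermediate_value_Icc (by norm_num) hg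
    (show (1 : ℝ) ∈ Set.Icc (g 1.10523) (g 1.10524) by
      constructor <;> norm_num [g])
  exact ⟨v, _, hv, rfl, h⟩

set_option exponentiation.threshold 1000 in
lemma exists_constants : ∃ τ α : ℝ, (1.6701 ≤ τ ∧ τ < 1.6702) ∧ (0.1950 ≤ α ∧ α < 0.1951) ∧
    τ ^ (-1 + α) + τ ^ (-4 + 3 * α) + 2 * τ ^ (-6 + 4 * α) + τ ^ (-8 + 5 * α) = 1 ∧
    τ ^ (-1 : ℝ) + τ ^ (-1 - 4 * α) = 1 := by
  obtain ⟨v, τ, ⟨hv1, hv2⟩, hτ, heq⟩ := exists_solution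
  have hv0 : 0 < v := lt_of_lt_of_le (by norm_num) hv1
  have hτ1 : (1.67015 : ℝ) ≤ τ := by
    have : (1.10524 : ℝ)⁻¹ ^ 4 ≤ v⁻¹ ^ 4 := by gcongr
    rw [hτ]
    refine le_trans ?_ (add_le_add_right this 1)
    norm_num
  have hτ2 : τ ≤ 1.67018 := by
    have : v⁻¹ ^ 4 ≤ (1.10523 : ℝ)⁻¹ ^ 4 := by gcongr
    rw [hτ]
    refine (add_le_add_right this 1).trans ?_
    norm_num
  have hτ0 : 0 < τ := lt_of_lt_of_le (by norm_num) hτ1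
  have hlog : 0 < Real.log τ := Real.log_pos (lt_of_lt_of_le (by norm_num) hτ1)
  have hvα : τ ^ (Real.log v / Real.log τ) = v := by
    rw [Real.rpow_def_of_pos hτ0, mul_div_cancel₀ _ hlog.ne', Real.exp_log hv0]
  have hα1 : 0.1950 ≤ Real.log v / Real.log τ := by
    have h : (τ : ℝ) ^ 39 ≤ v ^ 200 := by
      calc τ ^ 39 ≤ 1.67018 ^ 39 := by gcongr
        _ ≤ 1.10523 ^ 200 := by norm_num
        _ ≤ v ^ 200 := by gcongr
    have h := Real.log_le_log (by positivity) h
    rw [Real.log_pow, Real.log_pow] at h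
    rw [le_div_iff₀ hlog]
    push_cast at h
    linarith
  have hα2 : Real.log v / Real.log τ < 0.1951 := by
    -- `135 / 692` lies between `α` and `0.1951`
    have h : v ^ 692 < τ ^ 135 := by
      calc v ^ 692 ≤ 1.10524 ^ 692 := by gcongr
        _ < 1.67015 ^ 135 := by norm_num
        _ ≤ τ ^ 135 := by gcongr
    have h := Real.log_lt_log (by positivity) h
    rw [Real.log_pow, Real.log_pow] at h
    rw [div_lt_iff₀ hlog]
    push_cast at h
    linarith
  have hpow : ∀ (m k : ℕ), τ ^ (-(m : ℝ) + k * (Real.log v / Real.log τ)) = v ^ k / τ ^ m := by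
    intro m k
    rw [Real.rpow_add hτ0, Real.rpow_neg hτ0.le, Real.rpow_natCast, mul_comm (k : ℝ),
      Real.rpow_mul hτ0.le, hvα, Real.rpow_natCast, inv_mul_eq_div]
  refine ⟨τ, Real.log v / Real.log τ, ⟨by linarith, by linarith⟩, ⟨hα1, hα2⟩, ?_, ?_⟩
  · have h1 := hpow 1 1
    have h2 := hpow 4 3
    have h3 := hpow 6 4
    have h4 := hpow 8 5
    norm_num at h1 h2 h3 h4
    rw [h1, h2, h3, h4]
    exact heq
  · have h : τ ^ (-1 - 4 * (Real.log v / Real.log τ)) = τ⁻¹ * v⁻¹ ^ 4 := by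
      rw [Real.rpow_sub hτ0, Real.rpow_neg hτ0.le, Real.rpow_one, mul_comm (4 : ℝ),
        Real.rpow_mul hτ0.le, hvα, inv_pow, div_eq_mul_inv]
      norm_cast
    rw [h, Real.rpow_neg hτ0.le, Real.rpow_one, ← mul_one_add, ← hτ, inv_mul_cancel₀ hτ0.ne']

end ASP

/-- The base `τ = 1.6701...` of the bound, together with the auxiliary parameter
`α = 0.1950...`, is a solution of the two displayed equations. -/
theorem mainTheorem1 :
    ∃ τ α : ℝ,
      (1.6701 ≤ τ ∧ τ < 1.6702) ∧ (0.1950 ≤ α ∧ α < 0.1951) ∧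
      τ ^ (-1 + α) + τ ^ (-4 + 3 * α) + 2 * τ ^ (-6 + 4 * α) + τ ^ (-8 + 5 * α) = 1 ∧
      τ ^ (-1 : ℝ) + τ ^ (-1 - 4 * α) = 1 ∧
      (∀ (A : Type*) [DecidableEq A] (T : ASP.CNFTheory A), T.IsCNF 3 →
        {M : Finset A | T.IsMinimalModel M}.Finite ∧
        ({M : Finset A | T.IsMinimalModel M}.ncard : ℝ) ≤ τ ^ T.atoms.card) ∧
      (∀ (A : Type*) [DecidableEq A] (P : ASP.NormalProgram A), P.IsTProgram 3 →
        {M : Finset A | P.IsStableModel M}.Finite ∧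
        ({M : Finset A | P.IsStableModel M}.ncard : ℝ) ≤ τ ^ P.atoms.card) ∧
      (∀ (A : Type*) [DecidableEq A] (P : ASP.DisjunctiveProgram A), P.IsTProgram 3 →
        {M : Finset A | P.IsAnswerSet M}.Finite ∧
        ({M : Finset A | P.IsAnswerSet M}.ncard : ℝ) ≤ τ ^ P.atoms.card) := by
  obtain ⟨τ, α, hτ, hα, h1, h2⟩ := ASP.exists_constants
  have hbase : ∀ n : ℕ, ASP.base ^ n ≤ τ ^ n := fun n => by
    have : ASP.base ≤ τ := le_trans (by norm_num [ASP.base]) hτ.1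
    have h0 : 0 ≤ ASP.base := by norm_num [ASP.base]
    gcongr
  refine ⟨τ, α, hτ, hα, h1, h2, ?_, ?_, ?_⟩
  · intro A _ T hT
    exact ASP.ncard_le_of_subset_irr (fun M hM => ASP.CNFTheory.IsMinimalModel.mem_irr hM)
      ((ASP.CNFTheory.card_irr_le hT).trans (hbase _))
  · intro A _ P hP
    have := ASP.CNFTheory.card_irr_le hP.toDisjunctive.isCNF
    rw [ASP.DisjunctiveProgram.atoms_toCNF] at this
    have h := ASP.ncard_le_of_subset_irr
      (S := {M : Finset A | P.IsStableModel M})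
      (fun M hM => ASP.DisjunctiveProgram.IsAnswerSet.mem_irr
        (ASP.NormalProgram.IsStableModel.isAnswerSet hM)) (this.trans (hbase _))
    rwa [ASP.NormalProgram.atoms_toDisjunctive] at h
  · intro A _ P hP
    have := ASP.CNFTheory.card_irr_le hP.isCNF
    rw [ASP.DisjunctiveProgram.atoms_toCNF] at this
    exact ASP.ncard_le_of_subset_irr (S := {M : Finset A | P.IsAnswerSet M})
      (fun M hM => ASP.DisjunctiveProgram.IsAnswerSet.mem_irr hM) (this.trans (hbase _))
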